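/- Let $M$ be a smooth manifold (Hausdorff, second countable, without boundary) of dimension $2n+1$ with $n\ge 1$. Fix a normalisation $d\eta(X,Y)=c\,\bigl(X(\eta(Y))-Y(\eta(X))-\eta([X,Y])\bigr)$ of the exterior derivative of $1$-forms, with a constant $c>0$ (the usual conventions are $c=1$ and $c=\tfrac12$). A \emph{Sasakian structure} on $M$ is a quadruple $\mathcal S=(\xi,\eta,\Phi,g)$ of a smooth vector field, a smooth $1$-form, a smooth $(1,1)$-tensor field and a Riemannian metric such that $\eta(\xi)=1$, $\Phi^2=-1+\xi\otimes\eta$, $g(\Phi X,\Phi Y)=g(X,Y)-\eta(X)\eta(Y)$, $g(\Phi X,Y)=d\eta(X,Y)$, and such that the almost complex structure $I$ on the cone $C(M)=M\times\mathbb R^+$ given by $I(Y)=\Phi(Y)+\eta(Y)\,r\partial_r$, $I(r\partial_r)=-\xi$ is integrable (its Nijenhuis tensor vanishes). Let $(\mathcal D,J)$ be an integrable, strictly pseudoconvex CR structure of codimension one on $M$, and let $\mathcal S(\mathcal D,J)$ be the set of Sasakian structures $(\xi,\eta,\Phi,g)$ with $\ker\eta=\mathcal D$ and $\Phi|_{\mathcal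 D}=J$. Assume that $(\mathcal D,J)$ is of Sasaki type, i.e. $\mathcal S(\mathcal D,J)\neq\emptyset$. Let $\mathfrak{cr}(\mathcal D,J)$ be the space of smooth vector fields $X$ with $\pounds_X\eta=a\,\eta$ for some $a\in C^\infty(M)$, where $\eta$ is a $1$-form with kernel $\mathcal D$, and $\pounds_XJ=0$, with the $C^\infty$ compact-open topology; let $\mathfrak{CR}(\mathcal D,J)$ be the group of diffeomorphisms $\varphi$ of $M$ with $\varphi^*\eta=f\eta$ for some nowhere vanishing $f\in C^\infty(M)$ and $\varphi_*J=J\varphi_*$. Let $\mathfrak{cr}^+(\mathcal D,J)$ be the set of all $X\in\mathfrak{cr}(\mathcal D,J)$ such that $\eta(X)>0$ on $M$ for every $(\xi,\eta,\Phi,g)\in\mathcal S(\mathcal D,J)$. Then: (a) The map $(\xi,\eta,\Phi,g)\mapsto\xi$ is a bijection from $\mathcal S(\mathcal D,J)$ onto $\mathfrak{cr}^+(\mathcal D,J)$; for any $(\xi_0,\eta_0,\Phi_0,g_0)\in\mathcal S(\mathcal D,J)$, the structure corresponding to $\xi\in\mathfrak{cr}^+(\mathcal D,J)$ has contact form $\eta=\eta_0/\eta_0(\xi)$.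 (b) $\mathfrak{cr}^+(\mathcal D,J)$ is a convex cone in $\mathfrak{cr}(\mathcal D,J)$ (convex, and closed under multiplication by positive reals), and it is open in $\mathfrak{cr}(\mathcal D,J)$ if $M$ is compact. (c) $\mathfrak{cr}^+(\mathcal D,J)$ is invariant under the adjoint action $X\mapsto\varphi_*X$ of $\mathfrak{CR}(\mathcal D,J)$: $\varphi_*\bigl(\mathfrak{cr}^+(\mathcal D,J)\bigr)=\mathfrak{cr}^+(\mathcal D,J)$ for every $\varphi\in\mathfrak{CR}(\mathcal D,J)$. -/

import Mathlib

open scoped Manifold ContDiff UniformConvergence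

noncomputable section

namespace SasakiCR

section General

variable {E : Type*} [NormedAddCommGroup E] [NormedSpace ℝ E]
  {M : Type*} [TopologicalSpace M] [ChartedSpace E M] [IsManifold 𝓘(ℝ, E) ∞ M]

/-- The space `𝔛(M)` of smooth vector fields on `M`. -/
abbrev SmoothVF (E : Type*) [NormedAddCommGroup E] [NormedSpace ℝ E]
    (M : Type*) [TopologicalSpace M] [ChartedSpace E M] [IsManifold 𝓘(ℝ, E) ∞ M] : Type _ :=
  ContMDiffSection (M := M) 𝓘(ℝ, E) E ∞ (fun p : M => TangentSpace 𝓘(ℝ, E) p)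

/-- The vector field `X` read in the preferred chart at `x₀`, as a map from the model space to
itself (meaningful on the target of the chart). -/
def SmoothVF.localRep (X : SmoothVF E M) (x₀ : M) : E → E := fun y =>
  (trivializationAt E (fun p : M => TangentSpace 𝓘(ℝ, E) p) x₀
    ⟨(extChartAt 𝓘(ℝ, E) x₀).symm y, X ((extChartAt 𝓘(ℝ, E) x₀).symm y)⟩).2

/-- The `C^∞` compact-open topology on `𝔛(M)`: uniform convergence, on every compact subset of
every chart domain, of the local expressions together with all their derivatives. -/
instance SmoothVF.topology : TopologicalSpace (SmoothVF E M) :=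
  ⨅ (x₀ : M) (k : ℕ), TopologicalSpace.induced
    (fun X : SmoothVF E M =>
      UniformOnFun.ofFun {K : Set E | IsCompact K ∧ K ⊆ (extChartAt 𝓘(ℝ, E) x₀).target}
        (iteratedFDeriv ℝ k (X.localRep x₀)))
    inferInstance

/-- The Lie bracket `[X, Y]` at `p`. -/
abbrev bracket (X Y : ∀ p : M, TangentSpace 𝓘(ℝ, E) p) (p : M) : TangentSpace 𝓘(ℝ, E) p :=
  VectorField.mlieBracket 𝓘(ℝ, E) X Y p

/-- A smooth real function on `M`. -/
abbrev IsSmoothFun (E : Type*) [NormedAddCommGroup E] [NormedSpace ℝ E]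
    {M : Type*} [TopologicalSpace M] [ChartedSpace E M] (f : M → ℝ) : Prop :=
  ContMDiff 𝓘(ℝ, E) 𝓘(ℝ, ℝ) ∞ f

/-- A smooth `1`-form: a field of linear forms whose value on every smooth vector field is a
smooth function. -/
structure OneForm (E : Type*) [NormedAddCommGroup E] [NormedSpace ℝ E]
    (M : Type*) [TopologicalSpace M] [ChartedSpace E M] [IsManifold 𝓘(ℝ, E) ∞ M] where
  toFun : ∀ p : M, TangentSpace 𝓘(ℝ, E) p →ₗ[ℝ] ℝ
  smooth : ∀ X : SmoothVF E M, IsSmoothFun E (fun p => toFun p (X p))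

instance : CoeFun (OneForm E M) (fun _ => ∀ p : M, TangentSpace 𝓘(ℝ, E) p →ₗ[ℝ] ℝ) :=
  ⟨OneForm.toFun⟩

/-- The exterior derivative `dη(X, Y) = c (X(η(Y)) - Y(η(X)) - η([X, Y]))`. The constant `c` is
the normalisation of `d` on `1`-forms; the two conventions in use are `c = 1` and `c = 1/2`. -/
def OneForm.d (c : ℝ) (η : OneForm E M) (X Y : SmoothVF E M) (p : M) : ℝ :=
  c * (mvfderiv 𝓘(ℝ, E) (fun q => η q (Y q)) p (X p)
    - mvfderiv 𝓘(ℝ, E) (fun q => η q (X q)) p (Y p)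
    - η p (bracket X Y p))

/-- The Lie derivative of a `1`-form, `(£_X η)(Y) = X(η(Y)) - η([X, Y])`. -/
def OneForm.lieDeriv (X : SmoothVF E M) (η : OneForm E M) (Y : SmoothVF E M) (p : M) : ℝ :=
  mvfderiv 𝓘(ℝ, E) (fun q => η q (Y q)) p (X p) - η p (bracket X Y p)

/-- A smooth tensor field of type `(1,1)`: a field of endomorphisms taking smooth vector fields to
smooth vector fields. -/
structure EndoField (E : Type*) [NormedAddCommGroup E] [NormedSpace ℝ E]
    (M : Type*) [TopologicalSpace M] [ChartedSpace E M] [IsManifold 𝓘(ℝ, E) ∞ M] where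
  toFun : ∀ p : M, TangentSpace 𝓘(ℝ, E) p →ₗ[ℝ] TangentSpace 𝓘(ℝ, E) p
  smooth : ∀ X : SmoothVF E M, ContMDiff 𝓘(ℝ, E) 𝓘(ℝ, E).tangent ∞
    (fun p => (⟨p, toFun p (X p)⟩ : TangentBundle 𝓘(ℝ, E) M))

instance : CoeFun (EndoField E M)
    (fun _ => ∀ p : M, TangentSpace 𝓘(ℝ, E) p →ₗ[ℝ] TangentSpace 𝓘(ℝ, E) p) :=
  ⟨EndoField.toFun⟩

/-- A smooth Riemannian metric on `M`. -/
structure Metric (E : Type*) [NormedAddCommGroup E] [NormedSpace ℝ E]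
    (M : Type*) [TopologicalSpace M] [ChartedSpace E M] [IsManifold 𝓘(ℝ, E) ∞ M] where
  toFun : ∀ p : M, TangentSpace 𝓘(ℝ, E) p →ₗ[ℝ] TangentSpace 𝓘(ℝ, E) p →ₗ[ℝ] ℝ
  symm : ∀ (p : M) (u v : TangentSpace 𝓘(ℝ, E) p), toFun p u v = toFun p v u
  pos : ∀ (p : M) (v : TangentSpace 𝓘(ℝ, E) p), v ≠ 0 → 0 < toFun p v v
  smooth : ∀ X Y : SmoothVF E M, IsSmoothFun E (fun p => toFun p (X p) (Y p))

instance : CoeFun (Metric E M)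
    (fun _ => ∀ p : M, TangentSpace 𝓘(ℝ, E) p →ₗ[ℝ] TangentSpace 𝓘(ℝ, E) p →ₗ[ℝ] ℝ) :=
  ⟨Metric.toFun⟩

/-! ### The cone and normality -/

/-- The cone `C(M) = M × ℝ⁺`, as an open subset of `M × ℝ`. -/
def cone (M : Type*) : Set (M × ℝ) := {q | 0 < q.2}

/-- Vector fields on `M × ℝ`. The tangent space at `(p, r)` is `T_p M × ℝ`, where `(v, a)` stands
for `v + a ∂_r`. -/
abbrev ConeVF (E : Type*) [NormedAddCommGroup E] [NormedSpace ℝ E]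
    (M : Type*) [TopologicalSpace M] [ChartedSpace E M] : Type _ :=
  ∀ q : M × ℝ, TangentSpace (𝓘(ℝ, E).prod 𝓘(ℝ, ℝ)) q

/-- Smoothness on the cone. -/
def ConeVF.IsSmooth (X : ConeVF E M) : Prop :=
  ContMDiffOn (𝓘(ℝ, E).prod 𝓘(ℝ, ℝ)) (𝓘(ℝ, E).prod 𝓘(ℝ, ℝ)).tangent ∞
    (fun q => (⟨q, X q⟩ : TangentBundle (𝓘(ℝ, E).prod 𝓘(ℝ, ℝ)) (M × ℝ))) (cone M)

/-- The component in `T_p M` of a tangent vector of `M × ℝ` at `(p, r)`. -/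
def horPart (q : M × ℝ) (w : TangentSpace (𝓘(ℝ, E).prod 𝓘(ℝ, ℝ)) q) : TangentSpace 𝓘(ℝ, E) q.1 :=
  (w : E × ℝ).1

/-- The coefficient of `∂_r` in a tangent vector of `M × ℝ` at `(p, r)`. -/
def radPart (q : M × ℝ) (w : TangentSpace (𝓘(ℝ, E).prod 𝓘(ℝ, ℝ)) q) : ℝ :=
  (w : E × ℝ).2

/-- The tangent vector `v + a ∂_r` of `M × ℝ` at `(p, r)`. -/
def coneVec (q : M × ℝ) (v : TangentSpace 𝓘(ℝ, E) q.1) (a : ℝ) :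
    TangentSpace (𝓘(ℝ, E).prod 𝓘(ℝ, ℝ)) q :=
  ((v, a) : E × ℝ)

/-- The almost complex structure on the cone determined by
`I(Y) = Φ(Y) + η(Y) r∂_r` and `I(r∂_r) = -ξ`; hence `I(∂_r) = -ξ / r`. -/
def coneI (ξ : SmoothVF E M) (η : OneForm E M) (Φ : EndoField E M) (X : ConeVF E M) :
    ConeVF E M := fun q =>
  coneVec q (Φ q.1 (horPart q (X q)) - (radPart q (X q) / q.2) • ξ q.1)
    (η q.1 (horPart q (X q)) * q.2)

/-- `(ξ, η, Φ)` is normal: the almost complex structure on the cone is integrable, that is, its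
Nijenhuis tensor `[IX, IY] - I[IX, Y] - I[X, IY] - [X, Y]` vanishes on the cone. -/
def IsNormal (ξ : SmoothVF E M) (η : OneForm E M) (Φ : EndoField E M) : Prop :=
  let br : ConeVF E M → ConeVF E M → ConeVF E M :=
    VectorField.mlieBracket (𝓘(ℝ, E).prod 𝓘(ℝ, ℝ))
  let I : ConeVF E M → ConeVF E M := coneI ξ η Φ
  ∀ X Y : ConeVF E M, X.IsSmooth → Y.IsSmooth → ∀ q ∈ cone M,
    br (I X) (I Y) q - I (br (I X) Y) q - I (br X (I Y)) q - br X Y q = 0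

/-! ### Sasakian structures -/

/-- A Sasakian structure `(ξ, η, Φ, g)` on `M`: a normal contact metric structure
(with `d` on `1`-forms normalised by `c`). -/
structure SasakianStructure (c : ℝ) (E : Type*) [NormedAddCommGroup E] [NormedSpace ℝ E]
    (M : Type*) [TopologicalSpace M] [ChartedSpace E M] [IsManifold 𝓘(ℝ, E) ∞ M] where
  ξ : SmoothVF E M
  η : OneForm E M
  Φ : EndoField E M
  g : Metric E M
  eta_xi : ∀ p, η p (ξ p) = 1
  phi_sq : ∀ p v, Φ p (Φ p v) = -v + η p v • ξ p
  compatible : ∀ p u v, g p (Φ p u) (Φ p v) = g p u v - η p u * η p v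
  contact_metric : ∀ (X Y : SmoothVF E M) (p : M), g p (Φ p (X p)) (Y p) = η.d c X Y p
  normal : IsNormal ξ η Φ

/-! ### CR structures -/

/-- An (integrable, codimension one) CR structure `(𝒟, J)` on `M`: a smooth corank-one subbundle
`𝒟` of `TM` with a smooth complex structure `J` on its fibres whose Nijenhuis tensor vanishes. -/
structure CRStructure (E : Type*) [NormedAddCommGroup E] [NormedSpace ℝ E]
    (M : Type*) [TopologicalSpace M] [ChartedSpace E M] [IsManifold 𝓘(ℝ, E) ∞ M] where
  D : ∀ p : M, Submodule ℝ (TangentSpace 𝓘(ℝ, E) p)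
  J : ∀ p : M, D p →ₗ[ℝ] D p
  corank_one : ∀ p : M, Module.finrank ℝ (D p) + 1 = Module.finrank ℝ E
  /-- `𝒟` is spanned by its smooth sections -/
  smooth_D : ∀ (p : M) (v : D p), ∃ X : SmoothVF E M, (∀ q, X q ∈ D q) ∧ X p = v
  /-- `J` takes smooth sections of `𝒟` to smooth sections -/
  smooth_J : ∀ (X : SmoothVF E M) (hX : ∀ q, X q ∈ D q),
    ContMDiff 𝓘(ℝ, E) 𝓘(ℝ, E).tangent ∞
      (fun p => (⟨p, (J p ⟨X p, hX p⟩ : D p)⟩ : TangentBundle 𝓘(ℝ, E) M))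
  J_sq : ∀ (p : M) (v : D p), J p (J p v) = -v
  /-- `[JX, Y] + [X, JY]` is a section of `𝒟` and `J([JX, Y] + [X, JY]) = [JX, JY] - [X, Y]` -/
  integrable : ∀ (X Y : SmoothVF E M) (hX : ∀ q, X q ∈ D q) (hY : ∀ q, Y q ∈ D q) (p : M),
    ∃ h : bracket (fun q => (J q ⟨X q, hX q⟩ : D q)) Y p
        + bracket X (fun q => (J q ⟨Y q, hY q⟩ : D q)) p ∈ D p,
      ((J p ⟨_, h⟩ : D p) : TangentSpace 𝓘(ℝ, E) p) =
        bracket (fun q => (J q ⟨X q, hX q⟩ : D q)) (fun q => (J q ⟨Y q, hY q⟩ : D q)) p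
          - bracket X Y p

namespace CRStructure

variable (C : CRStructure E M)

/-- `X` is a section of `𝒟`. -/
def IsSection (X : SmoothVF E M) : Prop := ∀ p, X p ∈ C.D p

/-- The section `JX` of `𝒟`, for a section `X` of `𝒟`. -/
def applyJ (X : SmoothVF E M) (hX : C.IsSection X) : SmoothVF E M :=
  ⟨fun p => (C.J p ⟨X p, hX p⟩ : C.D p), C.smooth_J X hX⟩

/-- The `1`-form `η` represents `𝒟`: `ker η = 𝒟`. -/
def Represents (η : OneForm E M) : Prop := ∀ p, LinearMap.ker (η p) = C.D p

/-- Strict pseudoconvexity: for some `1`-form `η` representing `𝒟`, the Levi form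
`dη(X, JX)` is positive definite on `𝒟`. -/
def IsStrictlyPseudoconvex : Prop :=
  ∃ η : OneForm E M, C.Represents η ∧
    ∀ (X : SmoothVF E M) (hX : C.IsSection X) (p : M), X p ≠ 0 → 0 < η.d 1 X (C.applyJ X hX) p

/-- The set `𝒮(𝒟, J)` of Sasakian structures with underlying CR structure `(𝒟, J)`. -/
def sasakianStructures (c : ℝ) : Set (SasakianStructure c E M) :=
  {S | C.Represents S.η ∧ ∀ (p : M) (v : C.D p), S.Φ p v = C.J p v}

/-- `(𝒟, J)` is of Sasaki type. -/
def IsSasakiType (c : ℝ) : Prop := (C.sasakianStructures c).Nonempty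

/-- `X ∈ 𝔠𝔬𝔫(𝒟)`: `£_X η = a η` for a smooth function `a`. The condition is the same for all `η`
representing `𝒟`. -/
def IsContactField (X : SmoothVF E M) : Prop :=
  ∀ η : OneForm E M, C.Represents η → ∃ a : M → ℝ, IsSmoothFun E a ∧
    ∀ (Y : SmoothVF E M) (p : M), OneForm.lieDeriv X η Y p = a p * η p (Y p)

/-- `£_X J = 0`: the bracket with `X` preserves sections of `𝒟` and commutes with `J` there. -/
def PreservesJ (X : SmoothVF E M) : Prop :=
  ∀ (Y : SmoothVF E M) (hY : C.IsSection Y) (p : M), ∃ h : bracket X Y p ∈ C.D p,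
    bracket X (C.applyJ Y hY) p = (C.J p ⟨bracket X Y p, h⟩ : C.D p)

/-- The condition defining `𝔠𝔯(𝒟, J)`. -/
def IsCRField (X : SmoothVF E M) : Prop := C.IsContactField X ∧ C.PreservesJ X

theorem bracket_add_left [CompleteSpace E] (X Y Z : SmoothVF E M) (p : M) :
    bracket (X + Y : SmoothVF E M) Z p = bracket X Z p + bracket Y Z p :=
  VectorField.mlieBracket_add_left (X.contMDiff.mdifferentiableAt (by simp))
    (Y.contMDiff.mdifferentiableAt (by simp))

theorem bracket_smul_left [CompleteSpace E] (t : ℝ) (X Z : SmoothVF E M) (p : M) :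
    bracket (t • X : SmoothVF E M) Z p = t • bracket X Z p :=
  VectorField.mlieBracket_const_smul_left (X.contMDiff.mdifferentiableAt (by simp))

theorem IsCRField.add [CompleteSpace E] {X Y : SmoothVF E M} (hX : C.IsCRField X)
    (hY : C.IsCRField Y) : C.IsCRField (X + Y) := by
  refine ⟨fun η hη => ?_, fun Z hZ p => ?_⟩
  · obtain ⟨a, ha, ha'⟩ := hX.1 η hη
    obtain ⟨b, hb, hb'⟩ := hY.1 η hη
    refine ⟨fun p => a p + b p, ha.add hb, fun Z p => ?_⟩
    have h1 := ha' Z p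
    have h2 := hb' Z p
    simp only [OneForm.lieDeriv] at h1 h2 ⊢
    rw [bracket_add_left, ContMDiffSection.coe_add, Pi.add_apply, map_add, map_add]
    linarith
  · obtain ⟨h1, h1'⟩ := hX.2 Z hZ p
    obtain ⟨h2, h2'⟩ := hY.2 Z hZ p
    refine ⟨by rw [bracket_add_left]; exact (C.D p).add_mem h1 h2, ?_⟩
    rw [bracket_add_left, h1', h2', ← Submodule.coe_add, ← map_add]
    congr 2
    exact Subtype.ext (bracket_add_left X Y Z p).symm

theorem IsCRField.smul [CompleteSpace E] (t : ℝ) {X : SmoothVF E M} (hX : C.IsCRField X) :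
    C.IsCRField (t • X) := by
  refine ⟨fun η hη => ?_, fun Z hZ p => ?_⟩
  · obtain ⟨a, ha, ha'⟩ := hX.1 η hη
    refine ⟨fun p => t * a p, contMDiff_const.mul ha, fun Z p => ?_⟩
    have h1 := ha' Z p
    simp only [OneForm.lieDeriv] at h1 ⊢
    rw [bracket_smul_left, ContMDiffSection.coe_smul, Pi.smul_apply, map_smul, map_smul,
      smul_eq_mul, smul_eq_mul, ← mul_sub, h1, mul_assoc]
  · obtain ⟨h1, h1'⟩ := hX.2 Z hZ p
    refine ⟨by rw [bracket_smul_left]; exact (C.D p).smul_mem t h1, ?_⟩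
    rw [bracket_smul_left, h1', ← Submodule.coe_smul, ← map_smul]
    congr 2
    exact Subtype.ext (bracket_smul_left t X Z p).symm

/-- The space `𝔠𝔯(𝒟, J) = {X ∈ 𝔠𝔬𝔫(𝒟) | £_X J = 0}` of infinitesimal CR transformations; it
carries the subspace topology of `𝔛(M)`. -/
def cr [CompleteSpace E] : Submodule ℝ (SmoothVF E M) where
  carrier := {X | C.IsCRField X}
  add_mem' hX hY := IsCRField.add C hX hY
  zero_mem' := by
    have h : ∀ Z : SmoothVF E M, ∀ p, bracket (0 : SmoothVF E M) Z p = 0 := fun Z p => by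
      have := bracket_smul_left 0 (0 : SmoothVF E M) Z p
      rwa [zero_smul, zero_smul] at this
    refine ⟨fun η hη => ⟨fun _ => 0, contMDiff_const, fun Z p => ?_⟩, fun Z hZ p => ?_⟩
    · simp only [OneForm.lieDeriv]
      rw [h, ContMDiffSection.coe_zero, Pi.zero_apply, map_zero, map_zero]
      simp
    · refine ⟨by rw [h]; exact (C.D p).zero_mem, ?_⟩
      rw [h]
      have h0 : (⟨bracket (0 : SmoothVF E M) Z p, by rw [h]; exact (C.D p).zero_mem⟩ : C.D p) = 0 :=
        Subtype.ext (h Z p)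
      rw [h0, map_zero, Submodule.coe_zero]
  smul_mem' t _ hX := IsCRField.smul C t hX

/-- The set `𝔠𝔯⁺(𝒟, J)` of positive elements of `𝔠𝔯(𝒟, J)`: those `X` with `η(X) > 0` for every
`(ξ, η, Φ, g) ∈ 𝒮(𝒟, J)`. -/
def crPos [CompleteSpace E] (c : ℝ) : Set (SmoothVF E M) :=
  {X | X ∈ C.cr ∧ ∀ S ∈ C.sasakianStructures c, ∀ p, 0 < S.η p (X p)}

/-- The group `ℭℜ(𝒟, J)` of CR automorphisms: diffeomorphisms `φ` with `φ^*η = f η` for a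
nowhere vanishing smooth function `f` (for the forms `η` representing `𝒟`) and `φ_* J = J φ_*`. -/
def CRAut : Set (M ≃ₘ^∞⟮𝓘(ℝ, E), 𝓘(ℝ, E)⟯ M) :=
  {φ | (∀ η : OneForm E M, C.Represents η → ∃ f : M → ℝ, IsSmoothFun E f ∧ (∀ p, f p ≠ 0) ∧
        ∀ (p : M) (v : TangentSpace 𝓘(ℝ, E) p),
          η (φ p) (mfderiv 𝓘(ℝ, E) 𝓘(ℝ, E) φ p v) = f p * η p v) ∧
      ∀ (p : M) (v : C.D p), ∃ h : mfderiv 𝓘(ℝ, E) 𝓘(ℝ, E) φ p v ∈ C.D (φ p),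
        mfderiv 𝓘(ℝ, E) 𝓘(ℝ, E) φ p (C.J p v) = (C.J (φ p) ⟨_, h⟩ : C.D (φ p))}

end CRStructure

/-- The push-forward `φ_* X`, `(φ_* X)(q) = dφ (X(φ⁻¹ q))`, which is the adjoint action of a
diffeomorphism on vector fields. -/
def pushforward (φ : M ≃ₘ^∞⟮𝓘(ℝ, E), 𝓘(ℝ, E)⟯ M) (X : SmoothVF E M) : SmoothVF E M where
  toFun q := (mfderiv 𝓘(ℝ, E) 𝓘(ℝ, E) φ (φ.symm q) (X (φ.symm q)) : E)
  contMDiff_toFun := by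
    have h := ((φ.contMDiff.contMDiff_tangentMap (m := ∞) (by simp)).comp X.contMDiff).comp
      φ.symm.contMDiff
    convert h using 1
    funext q
    simp only [Function.comp_apply, tangentMap]
    have : φ (φ.symm q) = q := φ.apply_symm_apply q
    congr 1
    · exact this.symm

end General

end SasakiCR

end

/-!
Fix `(ξ₀, η₀, Φ₀, g₀) ∈ 𝒮(𝒟, J)`. For another `(ξ, η, Φ, g) ∈ 𝒮(𝒟, J)` one has
`dη₀ = η₀(ξ) dη` on `𝒟`, and both Levi forms are positive, so `η₀(ξ) > 0`. Hence positivity of a CR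
field need only be tested on the single form `η₀`, which gives the cone property and, since
`X ↦ η₀(X)` is continuous into `C(M, ℝ)`, openness. The same comparison of Levi forms shows that
`φ^*η₀ = f η₀` with `f > 0` for every CR automorphism `φ`.

A Sasakian structure is determined by `(𝒟, J)` and its Reeb field. Conversely, a CR field `ξ` with
`η₀(ξ) > 0` is the Reeb field of the structure with `η = η₀ / η₀(ξ)` and `Φ = Φ₀ ∘ π`, where `π` is
the projection onto `𝒟` along `ξ`. The cone structure of an almost contact structure inducing
`(𝒟, J)` is integrable exactly when `£_ξ J = 0`: its Nijenhuis tensor is tensorial, so it can be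
evaluated on the fields `X + a ξ + α r∂_r` with `X` a section of `𝒟`, whose brackets are those of
`M`, and there it vanishes by the integrability of `(𝒟, J)`.
-/

noncomputable section

open scoped Topology

namespace SasakiCR

section ProductBracket

variable {F H N F' H' N' : Type*} [NormedAddCommGroup F] [NormedSpace ℝ F] [TopologicalSpace H]
  (I : ModelWithCorners ℝ F H) [TopologicalSpace N] [ChartedSpace H N]
  [NormedAddCommGroup F'] [NormedSpace ℝ F'] [TopologicalSpace H']
  (I' : ModelWithCorners ℝ F' H') [TopologicalSpace N'] [ChartedSpace H' N']

/-- The expression of a vector field in the preferred chart at `x`, as a map from the model space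
to itself; it is meaningful on the target of the chart. -/
def chartRep (V : ∀ x : N, TangentSpace I x) (x : N) (y : F) : F :=
  mfderiv I 𝓘(ℝ, F) (extChartAt I x) ((extChartAt I x).symm y) (V ((extChartAt I x).symm y))

/-- The vector field `V + W` on a product manifold, for vector fields `V` and `W` on the two
factors. -/
def prodVF (V : ∀ x : N, TangentSpace I x) (W : ∀ x : N', TangentSpace I' x) (x : N × N') :
    TangentSpace (I.prod I') x :=
  ((V x.1, W x.2) : F × F')

variable {I I'}

theorem mpullbackWithin_eventuallyEq_chartRep [I.Boundaryless] [IsManifold I 1 N]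
    (V : ∀ x : N, TangentSpace I x) (x : N) :
    VectorField.mpullbackWithin 𝓘(ℝ, F) I (extChartAt I x).symm V (Set.range I)
      =ᶠ[𝓝 (extChartAt I x x)] chartRep I V x := by
  filter_upwards [extChartAt_target_mem_nhds (I := I) x] with y hy
  exact congrArg (fun A : TangentSpace I _ →L[ℝ] F => A (V _))
    (ContinuousLinearMap.inverse_eq (mfderivWithin_extChartAt_symm_comp_mfderiv_extChartAt hy)
      (mfderiv_extChartAt_comp_mfderivWithin_extChartAt_symm hy))

theorem mlieBracket_eq_lieBracket_chartRep [I.Boundaryless] [IsManifold I 1 N]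
    (V W : ∀ x : N, TangentSpace I x) (x : N) :
    VectorField.mlieBracket I V W x =
      VectorField.lieBracket ℝ (chartRep I V x) (chartRep I W x) (extChartAt I x x) := by
  have h_univ : (extChartAt I x).symm ⁻¹' Set.univ ∩ Set.range I = Set.univ := by
    rw [Set.preimage_univ, Set.univ_inter, I.range_eq_univ]
  have h_id : (mfderiv I 𝓘(ℝ, F) (extChartAt I x) x).inverse = ContinuousLinearMap.id ℝ F := by
    rw [mfderiv_extChartAt_self]
    exact ContinuousLinearMap.inverse_id
  rw [← VectorField.mlieBracketWithin_univ, VectorField.mlieBracketWithin_apply, h_univ, h_id]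
  exact (congrFun (VectorField.lieBracketWithin_univ (E := F)) _).trans
    ((mpullbackWithin_eventuallyEq_chartRep V x).lieBracket_vectorField_eq
      (mpullbackWithin_eventuallyEq_chartRep W x))

theorem differentiableAt_chartRep [I.Boundaryless] [IsManifold I 2 N] [CompleteSpace F]
    {V : ∀ x : N, TangentSpace I x} {x : N} (hV : MDiffAt (T% V) x) :
    DifferentiableAt ℝ (chartRep I V x) (extChartAt I x x) := by
  have : IsManifold I 1 N := IsManifold.of_le (n := 2) one_le_two
  have h := MDifferentiableWithinAt.differentiableWithinAt_mpullbackWithin_vectorField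
    (mdifferentiableWithinAt_univ.2 hV)
  refine DifferentiableAt.congr_of_eventuallyEq (h.differentiableAt ?_)
    (mpullbackWithin_eventuallyEq_chartRep V x).symm
  rw [Set.preimage_univ, Set.univ_inter, I.range_eq_univ]
  exact Filter.univ_mem

theorem chartRep_prodVF_eventuallyEq [I.Boundaryless] [I'.Boundaryless] [IsManifold I 1 N]
    [IsManifold I' 1 N'] (V : ∀ x : N, TangentSpace I x) (W : ∀ x : N', TangentSpace I' x)
    (x : N × N') :
    chartRep (I.prod I') (prodVF I I' V W) x =ᶠ[𝓝 (extChartAt (I.prod I') x x)]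
      fun y => (chartRep I V x.1 y.1, chartRep I' W x.2 y.2) := by
  filter_upwards [extChartAt_target_mem_nhds (I := I.prod I') x] with y hy
  have h_chart : (extChartAt (I.prod I') x : N × N' → F × F') =
      Prod.map (extChartAt I x.1) (extChartAt I' x.2) := by rw [extChartAt_prod]; rfl
  have h_symm : (extChartAt (I.prod I') x).symm y =
      ((extChartAt I x.1).symm y.1, (extChartAt I' x.2).symm y.2) := by
    rw [extChartAt_prod]; rfl
  rw [extChartAt_prod, PartialEquiv.prod_target] at hy
  have h := mfderiv_prodMap (p := ((extChartAt I x.1).symm y.1, (extChartAt I' x.2).symm y.2))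
    (mdifferentiableAt_extChartAt (I := I) (x := x.1)
      (by simpa using (extChartAt I x.1).map_target hy.1))
    (mdifferentiableAt_extChartAt (I := I') (x := x.2)
      (by simpa using (extChartAt I' x.2).map_target hy.2))
  rw [chartRep, h_symm, h_chart, modelWithCornersSelf_prod, ← chartedSpaceSelf_prod]
  exact congrArg (fun A : F × F' →L[ℝ] F × F' => A (V _, W _)) h

theorem lieBracket_prodMk {V₁ W₁ : F → F} {V₂ W₂ : F' → F'} {x : F × F'}
    (hV₁ : DifferentiableAt ℝ V₁ x.1) (hW₁ : DifferentiableAt ℝ W₁ x.1)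
    (hV₂ : DifferentiableAt ℝ V₂ x.2) (hW₂ : DifferentiableAt ℝ W₂ x.2) :
    VectorField.lieBracket ℝ (fun y : F × F' => (V₁ y.1, V₂ y.2)) (fun y => (W₁ y.1, W₂ y.2)) x =
      (VectorField.lieBracket ℝ V₁ W₁ x.1, VectorField.lieBracket ℝ V₂ W₂ x.2) := by
  have h_fderiv {f : F → F} {g : F' → F'} (hf : DifferentiableAt ℝ f x.1)
      (hg : DifferentiableAt ℝ g x.2) :
      fderiv ℝ (fun y : F × F' => (f y.1, g y.2)) x =
        (fderiv ℝ f x.1).prodMap (fderiv ℝ g x.2) :=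
    (HasFDerivAt.prodMap x hf.hasFDerivAt hg.hasFDerivAt).fderiv
  simp only [VectorField.lieBracket, h_fderiv hV₁ hV₂, h_fderiv hW₁ hW₂]
  rfl

theorem contMDiff_prodVF [IsManifold I 1 N] [IsManifold I' 1 N'] {n : WithTop ℕ∞}
    {V : ∀ x : N, TangentSpace I x} {W : ∀ x : N', TangentSpace I' x}
    (hV : CMDiff n (T% V)) (hW : CMDiff n (T% W)) : CMDiff n (T% (prodVF I I' V W)) :=
  contMDiff_equivTangentBundleProd_symm.comp
    ((hV.comp contMDiff_fst).prodMk (hW.comp contMDiff_snd))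

theorem mlieBracket_prodVF [I.Boundaryless] [I'.Boundaryless] [IsManifold I 2 N]
    [IsManifold I' 2 N'] [CompleteSpace F] [CompleteSpace F'] {V₁ W₁ : ∀ x : N, TangentSpace I x}
    {V₂ W₂ : ∀ x : N', TangentSpace I' x} {x : N × N'}
    (hV₁ : MDiffAt (T% V₁) x.1) (hW₁ : MDiffAt (T% W₁) x.1)
    (hV₂ : MDiffAt (T% V₂) x.2) (hW₂ : MDiffAt (T% W₂) x.2) :
    VectorField.mlieBracket (I.prod I') (prodVF I I' V₁ V₂) (prodVF I I' W₁ W₂) x =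
      prodVF I I' (VectorField.mlieBracket I V₁ W₁) (VectorField.mlieBracket I' V₂ W₂) x := by
  have : IsManifold I 1 N := IsManifold.of_le (n := 2) one_le_two
  have : IsManifold I' 1 N' := IsManifold.of_le (n := 2) one_le_two
  have h_point : extChartAt (I.prod I') x x = (extChartAt I x.1 x.1, extChartAt I' x.2 x.2) := by
    rw [extChartAt_prod]; rfl
  rw [mlieBracket_eq_lieBracket_chartRep, prodVF, mlieBracket_eq_lieBracket_chartRep,
    mlieBracket_eq_lieBracket_chartRep,
    (chartRep_prodVF_eventuallyEq V₁ V₂ x).lieBracket_vectorField_eq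
      (chartRep_prodVF_eventuallyEq W₁ W₂ x), h_point]
  exact lieBracket_prodMk (x := (extChartAt I x.1 x.1, extChartAt I' x.2 x.2))
    (differentiableAt_chartRep hV₁) (differentiableAt_chartRep hW₁)
    (differentiableAt_chartRep hV₂) (differentiableAt_chartRep hW₂)

end ProductBracket

section Nijenhuis

variable {F H N : Type*} [NormedAddCommGroup F] [NormedSpace ℝ F] [TopologicalSpace H]
  {I : ModelWithCorners ℝ F H} [TopologicalSpace N] [ChartedSpace H N]
  (J : ∀ x : N, TangentSpace I x →ₗ[ℝ] TangentSpace I x)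

/-- The Nijenhuis tensor `[JX, JY] - J[JX, Y] - J[X, JY] - [X, Y]` of an almost complex structure
`J`. -/
def nijenhuis (X Y : ∀ x : N, TangentSpace I x) (x : N) : TangentSpace I x :=
  VectorField.mlieBracket I (fun y => J y (X y)) (fun y => J y (Y y)) x
    - J x (VectorField.mlieBracket I (fun y => J y (X y)) Y x)
    - J x (VectorField.mlieBracket I X (fun y => J y (Y y)) x)
    - VectorField.mlieBracket I X Y x

theorem nijenhuis_swap (X Y : ∀ x : N, TangentSpace I x) (x : N) :
    nijenhuis J X Y x = -nijenhuis J Y X x := by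
  unfold nijenhuis
  rw [VectorField.mlieBracket_swap_apply (V := fun y => J y (X y)) (W := fun y => J y (Y y)),
    VectorField.mlieBracket_swap_apply (V := fun y => J y (X y)) (W := Y),
    VectorField.mlieBracket_swap_apply (V := X) (W := fun y => J y (Y y)),
    VectorField.mlieBracket_swap_apply (V := X) (W := Y), map_neg, map_neg]
  abel

variable {J} [CompleteSpace F] [IsManifold I 2 N] {x : N}

theorem tensorialAt_nijenhuis
    (hJ : ∀ X : ∀ y : N, TangentSpace I y, MDiffAt (T% X) x → MDiffAt (T% fun y => J y (X y)) x)
    (hJ_sq : ∀ v, J x (J x v) = -v) (Y : ∀ x : N, TangentSpace I x) :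
    TensorialAt I F (fun X => nijenhuis J X Y x) x := by
  refine ⟨fun {f X} hf hX => ?_, fun {X X'} hX hX' => ?_⟩
  · have h_smul : (fun y => J y ((f • X) y)) = f • fun y => J y (X y) :=
      funext fun y => (J y).map_smul (f y) (X y)
    simp only [nijenhuis, h_smul, VectorField.mlieBracket_smul_left hf (hJ X hX),
      VectorField.mlieBracket_smul_left hf hX, map_add, map_smul, hJ_sq]
    module
  · have h_add : (fun y => J y ((X + X') y)) = (fun y => J y (X y)) + fun y => J y (X' y) :=
      funext fun y => (J y).map_add (X y) (X' y)
    simp only [nijenhuis, h_add, VectorField.mlieBracket_add_left (hJ X hX) (hJ X' hX'),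
      VectorField.mlieBracket_add_left hX hX', map_add]
    abel

theorem nijenhuis_congr [FiniteDimensional ℝ F] [T2Space N]
    (hJ : ∀ X : ∀ y : N, TangentSpace I y, MDiffAt (T% X) x → MDiffAt (T% fun y => J y (X y)) x)
    (hJ_sq : ∀ v, J x (J x v) = -v) {X X' Y Y' : ∀ x : N, TangentSpace I x}
    (hX : MDiffAt (T% X) x) (hX' : MDiffAt (T% X') x) (hY : MDiffAt (T% Y) x)
    (hY' : MDiffAt (T% Y') x) (hXX' : X x = X' x) (hYY' : Y x = Y' x) :
    nijenhuis J X Y x = nijenhuis J X' Y' x := by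
  rw [(tensorialAt_nijenhuis hJ hJ_sq Y).pointwise hX hX' hXX', nijenhuis_swap,
    (tensorialAt_nijenhuis hJ hJ_sq X').pointwise hY hY' hYY', ← nijenhuis_swap]

end Nijenhuis

section VectorFields

variable {E : Type*} [NormedAddCommGroup E] [NormedSpace ℝ E]
  {M : Type*} [TopologicalSpace M] [ChartedSpace E M] [IsManifold 𝓘(ℝ, E) ∞ M]

namespace SmoothVF

theorem mdifferentiableAt (X : SmoothVF E M) (p : M) : MDiffAt (T% fun q => X q) p :=
  X.contMDiff.mdifferentiableAt (by simp)

/-- The product `f X` of a smooth function and a smooth vector field. -/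
def fsmul (f : M → ℝ) (hf : IsSmoothFun E f) (X : SmoothVF E M) : SmoothVF E M where
  toFun p := f p • X p
  contMDiff_toFun := ContMDiff.smul_section hf X.contMDiff

/-- The Lie bracket of two smooth vector fields, as a smooth vector field. -/
def lie [CompleteSpace E] (X Y : SmoothVF E M) : SmoothVF E M where
  toFun := bracket X Y
  contMDiff_toFun := by
    have : IsManifold 𝓘(ℝ, E) (((⊤ : ℕ∞) : WithTop ℕ∞) + 1) M := by simpa
    have : IsManifold 𝓘(ℝ, E) (minSmoothness ℝ 2) M := by
      rw [minSmoothness_of_isRCLikeNormedField]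
      infer_instance
    exact ContDiff.mlieBracket_vectorField (m := ⊤) (n := ⊤) X.contMDiff Y.contMDiff (by simp)

theorem exists_eventuallyEq [FiniteDimensional ℝ E] [T2Space M]
    {s : ∀ p : M, TangentSpace 𝓘(ℝ, E) p} {u : Set M} (hu : IsOpen u) (hs : CMDiff[u] ∞ (T% s))
    {p : M} (hp : p ∈ u) : ∃ X : SmoothVF E M, ∀ᶠ q in 𝓝 p, X q = s q := by
  obtain ⟨f, -, hf⟩ := (SmoothBumpFunction.nhds_basis_tsupport (I := 𝓘(ℝ, E)) p).mem_iff.1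
    (hu.mem_nhds hp)
  refine ⟨⟨fun q => f q • s q,
    ContMDiffOn.smul_section_of_tsupport f.contMDiff.contMDiffOn hu hf hs⟩, ?_⟩
  filter_upwards [f.eventuallyEq_one] with q hq
  change f q • s q = s q
  rw [hq, Pi.one_apply, one_smul]

theorem exists_frame [FiniteDimensional ℝ E] [T2Space M] (p : M) :
    ∃ e : Fin (Module.finrank ℝ E) → SmoothVF E M, ∀ᶠ q in 𝓝 p,
      ∀ v : TangentSpace 𝓘(ℝ, E) q, v = ∑ i, (Module.finBasis ℝ E).repr
        (trivializationAt E (fun p : M => TangentSpace 𝓘(ℝ, E) p) p ⟨q, v⟩).2 i • e i q := by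
  let b := Module.finBasis ℝ E
  let t := trivializationAt E (fun p : M => TangentSpace 𝓘(ℝ, E) p) p
  have hp : p ∈ t.baseSet := FiberBundle.mem_baseSet_trivializationAt' p
  choose e he using fun i =>
    exists_eventuallyEq t.open_baseSet (t.contMDiffOn_localFrame_baseSet ∞ b i) hp
  refine ⟨e, ?_⟩
  filter_upwards [Filter.eventually_all.2 he, t.open_baseSet.mem_nhds hp] with q hq hqb v
  have h_repr : (t.basisAt b hqb).repr v = b.repr (t ⟨q, v⟩).2 := by
    simp [Bundle.Trivialization.basisAt]
  refine ((t.basisAt b hqb).sum_repr v).symm.trans (Finset.sum_congr rfl fun i _ => ?_)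
  rw [hq i, t.localFrame_apply_of_mem_baseSet b hqb, h_repr]

end SmoothVF

theorem isSmoothFun_mvfderiv {f : M → ℝ} (hf : IsSmoothFun E f) (X : SmoothVF E M) :
    IsSmoothFun E (fun p => mvfderiv 𝓘(ℝ, E) f p (X p)) :=
  (contMDiff_snd_tangentBundle_modelSpace ℝ 𝓘(ℝ, ℝ)).comp
    ((hf.contMDiff_tangentMap (m := ∞) (by simp)).comp X.contMDiff)

variable [CompleteSpace E]

theorem bracket_add_right (X Y Z : SmoothVF E M) (p : M) :
    bracket X (Y + Z : SmoothVF E M) p = bracket X Y p + bracket X Z p :=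
  VectorField.mlieBracket_add_right (Y.mdifferentiableAt p) (Z.mdifferentiableAt p)

theorem bracket_smul_right (t : ℝ) (X Y : SmoothVF E M) (p : M) :
    bracket X (t • Y : SmoothVF E M) p = t • bracket X Y p :=
  VectorField.mlieBracket_const_smul_right (Y.mdifferentiableAt p)

theorem bracket_fsmul_right (X Y : SmoothVF E M) {f : M → ℝ} (hf : IsSmoothFun E f) (p : M) :
    bracket X (SmoothVF.fsmul f hf Y) p =
      mvfderiv 𝓘(ℝ, E) f p (X p) • Y p + f p • bracket X Y p :=
  VectorField.mlieBracket_smul_right (hf.mdifferentiableAt (by simp)) (Y.mdifferentiableAt p)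

theorem bracket_add_smul_add_smul (X Y Z : SmoothVF E M) (a b : ℝ) (p : M) :
    bracket (X + a • Z : SmoothVF E M) (Y + b • Z : SmoothVF E M) p =
      bracket X Y p + a • bracket Z Y p - b • bracket Z X p := by
  rw [CRStructure.bracket_add_left, CRStructure.bracket_smul_left, bracket_add_right,
    bracket_add_right, bracket_smul_right, bracket_smul_right, bracket, bracket, bracket, bracket,
    VectorField.mlieBracket_self, Pi.zero_apply,
    VectorField.mlieBracket_swap_apply (V := X) (W := Z)]
  module

end VectorFields

section TensorFields

variable {E : Type*} [NormedAddCommGroup E] [NormedSpace ℝ E]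
  {M : Type*} [TopologicalSpace M] [ChartedSpace E M] [IsManifold 𝓘(ℝ, E) ∞ M]

namespace EndoField

/-- The vector field `Φ X`. -/
def apply (Φ : EndoField E M) (X : SmoothVF E M) : SmoothVF E M :=
  ⟨fun p => Φ p (X p), Φ.smooth X⟩

/-- The composite `Φ ∘ Ψ` of two endomorphism fields. -/
def comp (Φ Ψ : EndoField E M) : EndoField E M where
  toFun p := Φ p ∘ₗ Ψ p
  smooth X := (Φ.apply (Ψ.apply X)).contMDiff

/-- The projection `v ↦ v - η(v) ξ` of the tangent bundle; when `η(ξ) = 1`, it is the projection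
onto `ker η` along `ξ`. -/
def horProj (ξ : SmoothVF E M) (η : OneForm E M) : EndoField E M where
  toFun p := LinearMap.id - (η p).smulRight (ξ p)
  smooth X := (X - SmoothVF.fsmul _ (η.smooth X) ξ).contMDiff

theorem horProj_apply (ξ : SmoothVF E M) (η : OneForm E M) (p : M) (v : TangentSpace 𝓘(ℝ, E) p) :
    horProj ξ η p v = v - η p v • ξ p := rfl

end EndoField

end TensorFields

section Cone

variable {E : Type*} [NormedAddCommGroup E] [NormedSpace ℝ E]
  {M : Type*} [TopologicalSpace M] [ChartedSpace E M] [IsManifold 𝓘(ℝ, E) ∞ M]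

theorem isOpen_cone : IsOpen (cone M) := isOpen_lt continuous_const continuous_snd

/-- The vector field `r ∂_r` on `ℝ`. -/
def euler : SmoothVF ℝ ℝ where
  toFun r := (r : ℝ)
  contMDiff_toFun := contMDiff_vectorSpace_iff_contDiff.2 contDiff_id

/-- The vector field `X + β r∂_r` on `M × ℝ`. -/
def prodField (X : SmoothVF E M) (β : ℝ) : ConeVF E M := fun q => coneVec q (X q.1) (β * q.2)

theorem prodField_eq_prodVF (X : SmoothVF E M) (β : ℝ) :
    prodField X β = prodVF 𝓘(ℝ, E) 𝓘(ℝ, ℝ) X (β • euler : SmoothVF ℝ ℝ) := rfl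

theorem prodField_sub_smul (X ξ : SmoothVF E M) (α β : ℝ) (q : M × ℝ) :
    prodField (X - α • ξ) β q =
      prodField X 0 q - α • prodField ξ 0 q + β • prodField (0 : SmoothVF E M) 1 q := by
  refine Prod.ext ?_ ?_
  · change X q.1 - α • ξ q.1 = X q.1 - α • ξ q.1 + β • 0
    rw [smul_zero, add_zero]
  · change β * q.2 = 0 * q.2 - α * (0 * q.2) + β * (1 * q.2)
    ring

theorem contMDiff_prodField (X : SmoothVF E M) (β : ℝ) : CMDiff ∞ (T% (prodField X β)) := by
  exact contMDiff_prodVF X.contMDiff (β • euler : SmoothVF ℝ ℝ).contMDiff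

theorem mdifferentiableAt_prodField (X : SmoothVF E M) (β : ℝ) (q : M × ℝ) :
    MDiffAt (T% (prodField X β)) q :=
  (contMDiff_prodField X β).mdifferentiableAt (by simp)

theorem mlieBracket_prodField [CompleteSpace E] (X Y : SmoothVF E M) (β γ : ℝ) (q : M × ℝ) :
    VectorField.mlieBracket (𝓘(ℝ, E).prod 𝓘(ℝ, ℝ)) (prodField X β) (prodField Y γ) q =
      coneVec q (bracket X Y q.1) 0 := by
  have h_euler : bracket (β • euler : SmoothVF ℝ ℝ) (γ • euler : SmoothVF ℝ ℝ) q.2 = 0 := by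
    rw [CRStructure.bracket_smul_left, bracket_smul_right, bracket, VectorField.mlieBracket_self,
      Pi.zero_apply, smul_zero, smul_zero]
  rw [prodField_eq_prodVF, prodField_eq_prodVF, mlieBracket_prodVF (X.mdifferentiableAt q.1)
    (Y.mdifferentiableAt q.1) ((β • euler : SmoothVF ℝ ℝ).mdifferentiableAt q.2)
    ((γ • euler : SmoothVF ℝ ℝ).mdifferentiableAt q.2)]
  exact congrArg (coneVec q _) h_euler

theorem sum_smul_prodField_zero {ι : Type*} [Fintype ι] (a : ι → ℝ) (X : ι → SmoothVF E M)
    (q : M × ℝ) : ∑ i, a i • prodField (X i) 0 q = coneVec q (∑ i, a i • X i q.1) 0 := by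
  let inl : TangentSpace 𝓘(ℝ, E) q.1 →ₗ[ℝ] TangentSpace (𝓘(ℝ, E).prod 𝓘(ℝ, ℝ)) q :=
    LinearMap.inl ℝ E ℝ
  have h_inl (i : ι) : prodField (X i) 0 q = inl (X i q.1) :=
    congrArg (coneVec q _) (zero_mul q.2)
  simp only [h_inl, ← map_smul, ← map_sum]
  rfl

theorem exists_eventuallyEq_sum_prodField [FiniteDimensional ℝ E] [T2Space M] {X : ConeVF E M}
    {q : M × ℝ} (hq : q ∈ cone M) (hX : MDiffAt (T% X) q) :
    ∃ (e : Fin (Module.finrank ℝ E) → SmoothVF E M) (f : Fin (Module.finrank ℝ E) → M × ℝ → ℝ)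
      (g : M × ℝ → ℝ), (∀ i, MDiffAt (f i) q) ∧ MDiffAt g q ∧
      ∀ᶠ y in 𝓝 q, X y = ∑ i, f i y • prodField (e i) 0 y + g y • prodField 0 1 y := by
  obtain ⟨e, he⟩ := SmoothVF.exists_frame (E := E) q.1
  have h_prod := ((contMDiff_equivTangentBundleProd (I := 𝓘(ℝ, E)) (M := M) (I' := 𝓘(ℝ, ℝ))
    (M' := ℝ) (n := 1)).mdifferentiableAt (by simp)).comp q hX
  have h_hor := ((mdifferentiableAt_totalSpace 𝓘(ℝ, E) _).1 h_prod.fst).2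
  have h_rad : MDiffAt (fun y => radPart y (X y)) q :=
    ((contMDiff_snd_tangentBundle_modelSpace ℝ 𝓘(ℝ, ℝ) (n := 1)).mdifferentiableAt
      (by simp)).comp q h_prod.snd
  have h_inv : MDiffAt (fun y : M × ℝ => y.2⁻¹) q :=
    (differentiableAt_inv (ne_of_gt hq)).mdifferentiableAt.comp q mdifferentiableAt_snd
  let f (i : Fin (Module.finrank ℝ E)) (y : M × ℝ) : ℝ := (Module.finBasis ℝ E).repr
    (trivializationAt E (fun p : M => TangentSpace 𝓘(ℝ, E) p) q.1 ⟨y.1, horPart y (X y)⟩).2 i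
  refine ⟨e, f, fun y => radPart y (X y) * y.2⁻¹, fun i => ?_, h_rad.mul h_inv, ?_⟩
  · exact ((Module.finBasis ℝ E).coord i).toContinuousLinearMap.mdifferentiableAt.comp q h_hor
  · filter_upwards [continuous_fst.continuousAt.eventually he, isOpen_cone.mem_nhds hq]
      with y hy (hr : 0 < y.2)
    rw [sum_smul_prodField_zero, ← hy]
    have h_rad_part : (radPart y (X y) * y.2⁻¹) • prodField (0 : SmoothVF E M) 1 y =
        coneVec y 0 (radPart y (X y)) := by
      refine Prod.ext (smul_zero (M := ℝ) (A := E) _) ?_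
      change radPart y (X y) * y.2⁻¹ * (1 * y.2) = radPart y (X y)
      field_simp
    rw [h_rad_part]
    exact Prod.ext (add_zero (M := E) _).symm (zero_add (M := ℝ) _).symm

variable (ξ : SmoothVF E M) (η : OneForm E M) (Φ : EndoField E M)

/-- The almost complex structure of the cone on a single tangent space. -/
def coneIAt (q : M × ℝ) : TangentSpace (𝓘(ℝ, E).prod 𝓘(ℝ, ℝ)) q →ₗ[ℝ]
    TangentSpace (𝓘(ℝ, E).prod 𝓘(ℝ, ℝ)) q where
  toFun w := coneVec q (Φ q.1 (horPart q w) - (radPart q w / q.2) • ξ q.1)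
    (η q.1 (horPart q w) * q.2)
  map_add' u v := by
    have h_hor : horPart q (u + v) = horPart q u + horPart q v := rfl
    have h_rad : radPart q (u + v) = radPart q u + radPart q v := rfl
    rw [h_hor, h_rad, map_add, map_add, add_div, add_smul, add_mul, add_sub_add_comm]
    rfl
  map_smul' t v := by
    have h_hor : horPart q (t • v) = t • horPart q v := rfl
    have h_rad : radPart q (t • v) = t * radPart q v := rfl
    rw [h_hor, h_rad, map_smul, map_smul, mul_div_assoc, mul_smul, ← smul_sub, smul_eq_mul,
      mul_assoc]
    rfl

theorem isNormal_iff_nijenhuis_eq_zero : IsNormal ξ η Φ ↔ ∀ X Y : ConeVF E M,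
    X.IsSmooth → Y.IsSmooth → ∀ q ∈ cone M, nijenhuis (coneIAt ξ η Φ) X Y q = 0 := Iff.rfl

variable {ξ η Φ}

theorem coneIAt_prodField (X : SmoothVF E M) (β : ℝ) {q : M × ℝ} (hq : q ∈ cone M) :
    coneIAt ξ η Φ q (prodField X β q) = prodField (Φ.apply X - β • ξ) (η q.1 (X q.1)) q := by
  change coneVec q (Φ q.1 (X q.1) - (β * q.2 / q.2) • ξ q.1) _ = _
  rw [mul_div_cancel_right₀ β (ne_of_gt hq)]
  rfl

theorem mdifferentiableAt_coneIAt [FiniteDimensional ℝ E] [T2Space M] {X : ConeVF E M}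
    {q : M × ℝ} (hq : q ∈ cone M) (hX : MDiffAt (T% X) q) :
    MDiffAt (T% fun y => coneIAt ξ η Φ y (X y)) q := by
  obtain ⟨e, f, g, hf, hg, h_eq⟩ := exists_eventuallyEq_sum_prodField hq hX
  have h_eta (i : Fin (Module.finrank ℝ E)) : MDiffAt (fun y : M × ℝ => η y.1 (e i y.1)) q :=
    ((η.smooth (e i)).mdifferentiableAt (by simp)).comp q mdifferentiableAt_fst
  have h_sum : MDiffAt (T% fun y => (∑ i, f i y • (prodField (Φ.apply (e i)) 0 y
      + η y.1 (e i y.1) • prodField 0 1 y)) - g y • prodField ξ 0 y) q :=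
    mdifferentiableAt_sub_section (.sum_section fun i _ => (hf i).smul_section
      (mdifferentiableAt_add_section (mdifferentiableAt_prodField _ _ q)
        ((h_eta i).smul_section (mdifferentiableAt_prodField _ _ q))))
      (hg.smul_section (mdifferentiableAt_prodField _ _ q))
  refine h_sum.congr_of_eventuallyEq ?_
  filter_upwards [h_eq, isOpen_cone.mem_nhds hq] with y hy hy_cone
  have h_frame (i : Fin (Module.finrank ℝ E)) : coneIAt ξ η Φ y (prodField (e i) 0 y) =
      prodField (Φ.apply (e i)) 0 y + η y.1 (e i y.1) • prodField (0 : SmoothVF E M) 1 y := by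
    rw [coneIAt_prodField _ _ hy_cone, prodField_sub_smul, zero_smul, sub_zero]
  have h_radial : coneIAt ξ η Φ y (prodField (0 : SmoothVF E M) 1 y) = -prodField ξ 0 y := by
    have h_zero : Φ.apply (0 : SmoothVF E M) = 0 := ContMDiffSection.ext fun p => (Φ p).map_zero
    have h_prodField : prodField (0 : SmoothVF E M) 0 y = 0 :=
      congrArg (coneVec y 0) (zero_mul y.2)
    rw [coneIAt_prodField _ _ hy_cone, prodField_sub_smul, h_zero, h_prodField,
      ContMDiffSection.coe_zero, Pi.zero_apply, map_zero, zero_smul, one_smul, zero_sub, add_zero]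
  simp only [hy, map_add, map_sum, map_smul, h_frame, h_radial, smul_neg, sub_eq_add_neg]

theorem nijenhuis_prodField [CompleteSpace E] {X Y : SmoothVF E M} {a b : ℝ}
    (hX : ∀ p, η p (X p) = a) (hY : ∀ p, η p (Y p) = b) (α β : ℝ) {q : M × ℝ}
    (hq : q ∈ cone M) :
    nijenhuis (coneIAt ξ η Φ) (prodField X α) (prodField Y β) q =
      coneVec q (bracket (Φ.apply X - α • ξ : SmoothVF E M) (Φ.apply Y - β • ξ : SmoothVF E M) q.1
        - Φ q.1 (bracket (Φ.apply X - α • ξ : SmoothVF E M) Y q.1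
          + bracket X (Φ.apply Y - β • ξ : SmoothVF E M) q.1) - bracket X Y q.1)
        (-(η q.1 (bracket (Φ.apply X - α • ξ : SmoothVF E M) Y q.1
          + bracket X (Φ.apply Y - β • ξ : SmoothVF E M) q.1)) * q.2) := by
  have h_I {X : SmoothVF E M} {a : ℝ} (hX : ∀ p, η p (X p) = a) (α : ℝ) :
      (fun y => coneIAt ξ η Φ y (prodField X α y)) =ᶠ[𝓝 q] prodField (Φ.apply X - α • ξ) a := by
    filter_upwards [isOpen_cone.mem_nhds hq] with y hy
    rw [coneIAt_prodField X α hy, hX]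
  have h_coneVec (v : TangentSpace 𝓘(ℝ, E) q.1) :
      coneIAt ξ η Φ q (coneVec q v 0) = coneVec q (Φ q.1 v) (η q.1 v * q.2) := by
    change coneVec q (Φ q.1 v - ((0 : ℝ) / q.2) • ξ q.1) (η q.1 v * q.2) = _
    rw [zero_div, zero_smul, sub_zero]
  have h_sub (v w : TangentSpace 𝓘(ℝ, E) q.1) (a b : ℝ) :
      coneVec q v a - coneVec q w b = coneVec q (v - w) (a - b) := rfl
  have h_refl (X : SmoothVF E M) (α : ℝ) := Filter.EventuallyEq.refl (𝓝 q) (prodField X α)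
  rw [nijenhuis, (h_I hX α).mlieBracket_vectorField_eq (h_I hY β),
    (h_I hX α).mlieBracket_vectorField_eq (h_refl Y β),
    (h_refl X α).mlieBracket_vectorField_eq (h_I hY β)]
  simp only [mlieBracket_prodField, h_coneVec, h_sub, map_add]
  congr 1
  · abel
  · ring

end Cone

section AlmostContact

variable {E : Type*} [NormedAddCommGroup E] [NormedSpace ℝ E]
  {M : Type*} [TopologicalSpace M] [ChartedSpace E M] [IsManifold 𝓘(ℝ, E) ∞ M]
  {ξ : SmoothVF E M} {η : OneForm E M} {Φ : EndoField E M}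

/-- `(ξ, η, Φ)` is an almost contact structure: `η(ξ) = 1` and `Φ² = -1 + ξ ⊗ η`. -/
structure IsAlmostContact (ξ : SmoothVF E M) (η : OneForm E M) (Φ : EndoField E M) : Prop where
  eta_xi : ∀ p, η p (ξ p) = 1
  phi_sq : ∀ p v, Φ p (Φ p v) = -v + η p v • ξ p

namespace IsAlmostContact

theorem phi_xi (h : IsAlmostContact ξ η Φ) (p : M) : Φ p (ξ p) = 0 := by
  have h_ne : ξ p ≠ 0 := fun h_zero => one_ne_zero <| by
    rw [← h.eta_xi p, h_zero, map_zero]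
  have h_phi_phi : Φ p (Φ p (ξ p)) = 0 := by
    rw [h.phi_sq, h.eta_xi, one_smul, neg_add_cancel]
  have h_smul : Φ p (ξ p) = η p (Φ p (ξ p)) • ξ p := by
    have h_cube := h.phi_sq p (Φ p (ξ p))
    rw [h_phi_phi, map_zero] at h_cube
    exact neg_add_eq_zero.1 h_cube.symm
  generalize η p (Φ p (ξ p)) = a at h_smul
  rw [h_smul, map_smul, h_smul, smul_smul, smul_eq_zero, mul_self_eq_zero] at h_phi_phi
  rw [h_smul, h_phi_phi.resolve_right h_ne, zero_smul]

theorem eta_phi (h : IsAlmostContact ξ η Φ) (p : M) (v : TangentSpace 𝓘(ℝ, E) p) :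
    η p (Φ p v) = 0 := by
  have h_cube := h.phi_sq p (Φ p v)
  rw [h.phi_sq p v, map_add, map_neg, map_smul, h.phi_xi, smul_zero, add_zero] at h_cube
  have h_smul := congrArg (η p) (left_eq_add.1 h_cube)
  rwa [map_smul, h.eta_xi, map_zero, smul_eq_mul, mul_one] at h_smul

theorem coneIAt_sq (h : IsAlmostContact ξ η Φ) {q : M × ℝ} (hq : q ∈ cone M)
    (w : TangentSpace (𝓘(ℝ, E).prod 𝓘(ℝ, ℝ)) q) :
    coneIAt ξ η Φ q (coneIAt ξ η Φ q w) = -w := by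
  have hr : q.2 ≠ 0 := ne_of_gt hq
  have h_coneVec (v : TangentSpace 𝓘(ℝ, E) q.1) (a : ℝ) : coneIAt ξ η Φ q (coneVec q v a) =
    coneVec q (Φ q.1 v - (a / q.2) • ξ q.1) (η q.1 v * q.2) := rfl
  rw [show w = coneVec q (horPart q w) (radPart q w) from rfl, h_coneVec, h_coneVec, map_sub,
    map_sub, map_smul, map_smul, h.phi_sq, h.phi_xi, h.eta_phi, h.eta_xi,
    mul_div_cancel_right₀ _ hr, smul_eq_mul, mul_one, zero_sub, neg_mul, div_mul_cancel₀ _ hr,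
    smul_zero, sub_zero, add_sub_cancel_right]
  rfl

end IsAlmostContact

namespace CRStructure

variable {C : CRStructure E M}

theorem Represents.mem_iff (hη : C.Represents η) {p : M} {v : TangentSpace 𝓘(ℝ, E) p} :
    v ∈ C.D p ↔ η p v = 0 := by
  rw [← hη p, LinearMap.mem_ker]

/-- The almost contact structure `(ξ, η, Φ)` induces the CR structure `C = (𝒟, J)`: `ker η = 𝒟`
and `Φ` restricts to `J` on `𝒟`. -/
structure IsAdapted (C : CRStructure E M) (ξ : SmoothVF E M) (η : OneForm E M)
    (Φ : EndoField E M) : Prop extends IsAlmostContact ξ η Φ where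
  represents : C.Represents η
  phi_eq_J : ∀ (p : M) (v : C.D p), Φ p v = C.J p v

namespace IsAdapted

variable (h : C.IsAdapted ξ η Φ)
include h

theorem applyJ_eq {X : SmoothVF E M} (hX : C.IsSection X) : C.applyJ X hX = Φ.apply X :=
  ContMDiffSection.ext fun p => (h.phi_eq_J p ⟨X p, hX p⟩).symm

theorem preservesJ_iff {X : SmoothVF E M} : C.PreservesJ X ↔
    ∀ Y : SmoothVF E M, C.IsSection Y → ∀ p, η p (bracket X Y p) = 0 ∧
      bracket X (Φ.apply Y) p = Φ p (bracket X Y p) := by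
  refine forall₃_congr fun Y hY p => ?_
  rw [h.applyJ_eq hY, ← h.represents.mem_iff, ← exists_prop]
  exact exists_congr fun hp => by rw [← h.phi_eq_J]

theorem integrable {X Y : SmoothVF E M} (hX : C.IsSection X) (hY : C.IsSection Y) (p : M) :
    η p (bracket (Φ.apply X) Y p + bracket X (Φ.apply Y) p) = 0 ∧
      Φ p (bracket (Φ.apply X) Y p + bracket X (Φ.apply Y) p) =
        bracket (Φ.apply X) (Φ.apply Y) p - bracket X Y p := by
  obtain ⟨hp, hJ⟩ := C.integrable X Y hX hY p
  rw [← h.phi_eq_J] at hJ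
  change bracket (C.applyJ X hX) Y p + bracket X (C.applyJ Y hY) p ∈ C.D p at hp
  change Φ p (bracket (C.applyJ X hX) Y p + bracket X (C.applyJ Y hY) p) =
    bracket (C.applyJ X hX) (C.applyJ Y hY) p - bracket X Y p at hJ
  rw [h.applyJ_eq hX, h.applyJ_eq hY] at hp hJ
  exact ⟨h.represents.mem_iff.1 hp, hJ⟩

theorem eta_add_smul {X : SmoothVF E M} (hX : C.IsSection X) (a : ℝ) (p : M) :
    η p ((X + a • ξ : SmoothVF E M) p) = a := by
  change η p (X p + a • ξ p) = a
  rw [map_add, map_smul, h.eta_xi, h.represents.mem_iff.1 (hX p), zero_add, smul_eq_mul, mul_one]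

theorem eq_prodField {q : M × ℝ} (hq : q ∈ cone M)
    (w : TangentSpace (𝓘(ℝ, E).prod 𝓘(ℝ, ℝ)) q) :
    ∃ (X : SmoothVF E M) (_ : C.IsSection X) (a α : ℝ), w = prodField (X + a • ξ) α q := by
  have h_mem : horPart q w - η q.1 (horPart q w) • ξ q.1 ∈ C.D q.1 := by
    rw [h.represents.mem_iff, map_sub, map_smul, h.eta_xi, smul_eq_mul, mul_one, sub_self]
  obtain ⟨X, hX, hXq⟩ := C.smooth_D q.1 ⟨_, h_mem⟩
  refine ⟨X, hX, η q.1 (horPart q w), radPart q w / q.2, ?_⟩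
  change coneVec q (horPart q w) (radPart q w) =
    coneVec q (X q.1 + η q.1 (horPart q w) • ξ q.1) (radPart q w / q.2 * q.2)
  rw [hXq, div_mul_cancel₀ _ (ne_of_gt hq), sub_add_cancel]

variable [CompleteSpace E]

theorem preservesJ_of_isNormal (hN : IsNormal ξ η Φ) : C.PreservesJ ξ := by
  refine h.preservesJ_iff.2 fun Y hY p => ?_
  have hp : ((p, 1) : M × ℝ) ∈ cone M := zero_lt_one (α := ℝ)
  have h_nij := hN (prodField Y 0) (prodField 0 1) (contMDiff_prodField Y 0).contMDiffOn
    (contMDiff_prodField 0 1).contMDiffOn _ hp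
  have h_bracket_zero (X : SmoothVF E M) : bracket X (0 : SmoothVF E M) p = 0 := by
    simpa using bracket_smul_right 0 X 0 p
  have h_bracket_xi (X : SmoothVF E M) :
      bracket X (Φ.apply (0 : SmoothVF E M) - (1 : ℝ) • ξ : SmoothVF E M) p = bracket ξ X p := by
    have h_neg : Φ.apply (0 : SmoothVF E M) - (1 : ℝ) • ξ = (-1 : ℝ) • ξ :=
      ContMDiffSection.ext fun p => by
        change Φ p 0 - (1 : ℝ) • ξ p = (-1 : ℝ) • ξ p
        rw [map_zero, neg_smul, zero_sub]
    rw [h_neg, bracket_smul_right, neg_one_smul]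
    exact VectorField.mlieBracket_swap_apply.symm
  have h_eq := (nijenhuis_prodField (fun p => h.represents.mem_iff.1 (hY p))
    (fun p => (η p).map_zero) 0 1 hp).symm.trans h_nij
  simp only [zero_smul, sub_zero, h_bracket_zero, h_bracket_xi, zero_add, mul_one] at h_eq
  exact ⟨neg_eq_zero.1 (congrArg Prod.snd h_eq), sub_eq_zero.1 (congrArg Prod.fst h_eq)⟩

theorem nijenhuis_eq_zero_of_preservesJ (hξ : C.PreservesJ ξ) {X Y : SmoothVF E M}
    (hX : C.IsSection X) (hY : C.IsSection Y) (a b α β : ℝ) {q : M × ℝ} (hq : q ∈ cone M) :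
    nijenhuis (coneIAt ξ η Φ) (prodField (X + a • ξ) α) (prodField (Y + b • ξ) β) q = 0 := by
  have h_phi (X : SmoothVF E M) (a α : ℝ) :
      Φ.apply (X + a • ξ) - α • ξ = Φ.apply X + (-α) • ξ := by
    ext p
    change Φ p (X p + a • ξ p) - α • ξ p = Φ p (X p) + (-α) • ξ p
    rw [map_add, map_smul, h.phi_xi, smul_zero, add_zero, neg_smul, sub_eq_add_neg]
  obtain ⟨h_eta, h_integrable⟩ := h.integrable hX hY q.1
  obtain ⟨hX_eta, hX_phi⟩ := h.preservesJ_iff.1 hξ X hX q.1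
  obtain ⟨hY_eta, hY_phi⟩ := h.preservesJ_iff.1 hξ Y hY q.1
  rw [map_add] at h_eta h_integrable
  rw [nijenhuis_prodField (h.eta_add_smul hX a) (h.eta_add_smul hY b) α β hq, h_phi, h_phi]
  simp only [bracket_add_smul_add_smul, map_add, map_sub, map_smul, hX_phi, hY_phi, h.phi_sq,
    h.eta_phi, hX_eta, hY_eta, smul_eq_mul, mul_zero, zero_smul, add_zero, sub_zero, h_eta,
    neg_zero, zero_mul]
  refine congrArg (coneVec q · 0) (?_ : _ = (0 : TangentSpace 𝓘(ℝ, E) q.1))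
  rw [eq_add_of_sub_eq h_integrable.symm]
  module

theorem isNormal_of_preservesJ [FiniteDimensional ℝ E] [T2Space M] (hξ : C.PreservesJ ξ) :
    IsNormal ξ η Φ := by
  refine (isNormal_iff_nijenhuis_eq_zero ξ η Φ).2 fun X Y hX hY q hq => ?_
  have h_mdiff {X : ConeVF E M} (hX : X.IsSmooth) : MDiffAt (T% X) q :=
    (hX.contMDiffAt (isOpen_cone.mem_nhds hq)).mdifferentiableAt (by simp)
  obtain ⟨X', hX', a, α, hXq⟩ := h.eq_prodField hq (X q)
  obtain ⟨Y', hY', b, β, hYq⟩ := h.eq_prodField hq (Y q)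
  rw [nijenhuis_congr (fun _ => mdifferentiableAt_coneIAt hq) (h.coneIAt_sq hq) (h_mdiff hX)
    (mdifferentiableAt_prodField _ _ q) (h_mdiff hY) (mdifferentiableAt_prodField _ _ q) hXq hYq]
  exact h.nijenhuis_eq_zero_of_preservesJ hξ hX' hY' a b α β hq

end IsAdapted

end CRStructure

end AlmostContact

section Contact

variable {E : Type*} [NormedAddCommGroup E] [NormedSpace ℝ E]
  {M : Type*} [TopologicalSpace M] [ChartedSpace E M]

theorem mvfderiv_eq_zero_of_const {f : M → ℝ} {a : ℝ} (hf : ∀ p, f p = a) (p : M)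
    (v : TangentSpace 𝓘(ℝ, E) p) : mvfderiv 𝓘(ℝ, E) f p v = 0 := by
  rw [show f = fun _ => a from funext hf, mvfderiv_const]
  rfl

variable [IsManifold 𝓘(ℝ, E) ∞ M] {ξ : SmoothVF E M} {η : OneForm E M}

theorem EndoField.eq_horProj_add (ξ : SmoothVF E M) (η : OneForm E M) (X : SmoothVF E M) :
    X = (horProj ξ η).apply X + SmoothVF.fsmul _ (η.smooth X) ξ :=
  ContMDiffSection.ext fun p => (sub_add_cancel (X p) (η p (X p) • ξ p)).symm

namespace OneForm

theorem d_eq_lieDeriv_sub (c : ℝ) (η : OneForm E M) (X Y : SmoothVF E M) (p : M) :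
    η.d c X Y p = c * (lieDeriv X η Y p - mvfderiv 𝓘(ℝ, E) (fun q => η q (X q)) p (Y p)) := by
  rw [d, lieDeriv, sub_right_comm]

theorem d_swap (c : ℝ) (η : OneForm E M) (X Y : SmoothVF E M) (p : M) :
    η.d c X Y p = -η.d c Y X p := by
  rw [d, d, bracket, VectorField.mlieBracket_swap_apply, map_neg]
  ring

theorem eta_horProj (hξ : ∀ p, η p (ξ p) = 1) (p : M) (v : TangentSpace 𝓘(ℝ, E) p) :
    η p (EndoField.horProj ξ η p v) = 0 := by
  rw [EndoField.horProj_apply, map_sub, map_smul, hξ, smul_eq_mul, mul_one, sub_self]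

variable [CompleteSpace E]

theorem lieDeriv_add (X : SmoothVF E M) (η : OneForm E M) (Y Z : SmoothVF E M) (p : M) :
    lieDeriv X η (Y + Z) p = lieDeriv X η Y p + lieDeriv X η Z p := by
  have h_sum : (fun q => η q ((Y + Z : SmoothVF E M) q)) =
      (fun q => η q (Y q)) + fun q => η q (Z q) := funext fun q => (η q).map_add _ _
  rw [lieDeriv, h_sum, mvfderiv_add ((η.smooth Y).mdifferentiableAt (by simp))
    ((η.smooth Z).mdifferentiableAt (by simp)), bracket_add_right, map_add, lieDeriv, lieDeriv]
  exact add_sub_add_comm _ _ _ _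

theorem lieDeriv_fsmul (X : SmoothVF E M) (η : OneForm E M) {f : M → ℝ} (hf : IsSmoothFun E f)
    (Y : SmoothVF E M) (p : M) :
    lieDeriv X η (SmoothVF.fsmul f hf Y) p = f p * lieDeriv X η Y p := by
  have h_prod : (fun q => η q (SmoothVF.fsmul f hf Y q)) = f * fun q => η q (Y q) :=
    funext fun q => (η q).map_smul _ _
  rw [lieDeriv, h_prod, mvfderiv_mul (hf.mdifferentiableAt (by simp))
    ((η.smooth Y).mdifferentiableAt (by simp)), bracket_fsmul_right, map_add, map_smul, map_smul,
    lieDeriv]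
  simp only [add_apply, smul_apply, smul_eq_mul]
  ring

theorem d_add_right (c : ℝ) (η : OneForm E M) (X Y Z : SmoothVF E M) (p : M) :
    η.d c X (Y + Z) p = η.d c X Y p + η.d c X Z p := by
  simp only [d_eq_lieDeriv_sub, lieDeriv_add, ContMDiffSection.coe_add, Pi.add_apply, map_add]
  ring

theorem d_fsmul_right (c : ℝ) (η : OneForm E M) (X : SmoothVF E M) {f : M → ℝ}
    (hf : IsSmoothFun E f) (Y : SmoothVF E M) (p : M) :
    η.d c X (SmoothVF.fsmul f hf Y) p = f p * η.d c X Y p := by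
  rw [d_eq_lieDeriv_sub, lieDeriv_fsmul, d_eq_lieDeriv_sub,
    show SmoothVF.fsmul f hf Y p = f p • Y p from rfl, map_smul, smul_eq_mul]
  ring

theorem d_eq_d_horProj {c : ℝ} (hξ : ∀ (X : SmoothVF E M) p, η.d c X ξ p = 0)
    (X Y : SmoothVF E M) (p : M) :
    η.d c X Y p = η.d c ((EndoField.horProj ξ η).apply X) ((EndoField.horProj ξ η).apply Y) p := by
  have h_right (X Y : SmoothVF E M) :
      η.d c X Y p = η.d c X ((EndoField.horProj ξ η).apply Y) p := by
    conv_lhs => rw [EndoField.eq_horProj_add ξ η Y]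
    rw [d_add_right, d_fsmul_right, hξ, mul_zero, add_zero]
  rw [h_right, d_swap, h_right, ← d_swap]

end OneForm

namespace CRStructure

variable {C : CRStructure E M}

theorem Represents.isSection_horProj (hη : C.Represents η) (hξ : ∀ p, η p (ξ p) = 1)
    (X : SmoothVF E M) : C.IsSection ((EndoField.horProj ξ η).apply X) :=
  fun p => hη.mem_iff.2 (OneForm.eta_horProj hξ p (X p))

theorem Represents.eq_mul (hη : C.Represents η) (hξ : ∀ p, η p (ξ p) = 1) {η' : OneForm E M}
    (hη' : C.Represents η') (p : M) (v : TangentSpace 𝓘(ℝ, E) p) :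
    η' p v = η p v * η' p (ξ p) := by
  have h_ker := hη'.mem_iff.1 (hη.mem_iff.2 (OneForm.eta_horProj hξ p v))
  rwa [EndoField.horProj_apply, map_sub, map_smul, sub_eq_zero] at h_ker

theorem Represents.exists_smoothVF_eq (hη : C.Represents η) (hξ : ∀ p, η p (ξ p) = 1) (p : M)
    (v : TangentSpace 𝓘(ℝ, E) p) : ∃ X : SmoothVF E M, X p = v := by
  obtain ⟨X, -, hX⟩ := C.smooth_D p ⟨_, hη.mem_iff.2 (OneForm.eta_horProj hξ p v)⟩
  refine ⟨X + η p v • ξ, ?_⟩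
  change X p + η p v • ξ p = v
  rw [hX]
  exact sub_add_cancel v _

theorem Represents.d_of_isSection (hη : C.Represents η) (c : ℝ) {X Y : SmoothVF E M}
    (hX : C.IsSection X) (hY : C.IsSection Y) (p : M) :
    η.d c X Y p = -(c * η p (bracket X Y p)) := by
  rw [OneForm.d, mvfderiv_eq_zero_of_const (fun q => hη.mem_iff.1 (hY q)),
    mvfderiv_eq_zero_of_const (fun q => hη.mem_iff.1 (hX q)), sub_zero, zero_sub, mul_neg]

theorem Represents.d_eq_mul (hη : C.Represents η) (hξ : ∀ p, η p (ξ p) = 1) {η' : OneForm E M}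
    (hη' : C.Represents η') (c : ℝ) {X Y : SmoothVF E M} (hX : C.IsSection X)
    (hY : C.IsSection Y) (p : M) : η'.d c X Y p = η' p (ξ p) * η.d c X Y p := by
  rw [hη'.d_of_isSection c hX hY, hη.d_of_isSection c hX hY, hη.eq_mul hξ hη']
  ring

namespace PreservesJ

variable {X : SmoothVF E M}

theorem lieDeriv_eq_zero (hX : C.PreservesJ X) (hη : C.Represents η) {Z : SmoothVF E M}
    (hZ : C.IsSection Z) (p : M) : OneForm.lieDeriv X η Z p = 0 := by
  rw [OneForm.lieDeriv, mvfderiv_eq_zero_of_const (fun q => hη.mem_iff.1 (hZ q)),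
    hη.mem_iff.1 (hX Z hZ p).1, sub_zero]

variable [CompleteSpace E]

theorem lieDeriv_eq_mul (hX : C.PreservesJ X) (hη : C.Represents η) (hξ : ∀ p, η p (ξ p) = 1)
    {η' : OneForm E M} (hη' : C.Represents η') (Y : SmoothVF E M) (p : M) :
    OneForm.lieDeriv X η' Y p = η p (Y p) * OneForm.lieDeriv X η' ξ p := by
  conv_lhs => rw [EndoField.eq_horProj_add ξ η Y]
  rw [OneForm.lieDeriv_add, OneForm.lieDeriv_fsmul,
    hX.lieDeriv_eq_zero hη' (hη.isSection_horProj hξ Y), zero_add]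

theorem isContactField (hX : C.PreservesJ X) (hη : C.Represents η) (hξ : ∀ p, η p (ξ p) = 1) :
    C.IsContactField X := by
  intro η' hη'
  have h_ne (p : M) : η' p (ξ p) ≠ 0 := fun h_zero =>
    one_ne_zero ((hξ p).symm.trans (hη.mem_iff.1 (hη'.mem_iff.2 h_zero)))
  have h_smooth : IsSmoothFun E (fun p => OneForm.lieDeriv X η' ξ p) :=
    (isSmoothFun_mvfderiv (η'.smooth ξ) X).sub (η'.smooth (SmoothVF.lie X ξ))
  refine ⟨fun p => OneForm.lieDeriv X η' ξ p / η' p (ξ p), h_smooth.div₀ (η'.smooth ξ) h_ne,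
    fun Y p => ?_⟩
  rw [hX.lieDeriv_eq_mul hη hξ hη', hη.eq_mul hξ hη' p (Y p), mul_left_comm,
    div_mul_cancel₀ _ (h_ne p)]

theorem d_apply_eq_zero (hX : C.PreservesJ ξ) (hη : C.Represents η) (hξ : ∀ p, η p (ξ p) = 1)
    (c : ℝ) (Y : SmoothVF E M) (p : M) : η.d c Y ξ p = 0 := by
  have h_self : OneForm.lieDeriv ξ η ξ p = 0 := by
    rw [OneForm.lieDeriv, mvfderiv_eq_zero_of_const hξ, bracket, VectorField.mlieBracket_self,
      Pi.zero_apply, map_zero, sub_zero]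
  rw [OneForm.d_swap, OneForm.d_eq_lieDeriv_sub, hX.lieDeriv_eq_mul hη hξ hη, h_self,
    mvfderiv_eq_zero_of_const hξ, mul_zero, sub_zero, mul_zero, neg_zero]

end PreservesJ

end CRStructure

end Contact

section Sasakian

variable {E : Type*} [NormedAddCommGroup E] [NormedSpace ℝ E]
  {M : Type*} [TopologicalSpace M] [ChartedSpace E M] [IsManifold 𝓘(ℝ, E) ∞ M]
  {c : ℝ} {S S' : SasakianStructure c E M}

attribute [ext] OneForm EndoField Metric SasakianStructure

theorem EndoField.horProj_of_eta_eq_zero {ξ : SmoothVF E M} {η : OneForm E M} {p : M}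
    {v : TangentSpace 𝓘(ℝ, E) p} (hv : η p v = 0) : horProj ξ η p v = v := by
  rw [horProj_apply, hv, zero_smul, sub_zero]

/-- The `1`-form `η / η(ξ)`, the multiple of `η` that takes the value `1` on `ξ`. -/
def OneForm.normalize (ξ : SmoothVF E M) (η : OneForm E M) (h : ∀ p, η p (ξ p) ≠ 0) :
    OneForm E M where
  toFun p := (η p (ξ p))⁻¹ • η p
  smooth X := ((η.smooth ξ).inv₀ h).mul (η.smooth X)

/-- The metric `f g(π ·, π ·) + η ⊗ η`, where `π v = v - η(v) ξ`. -/
def Metric.deform (g : Metric E M) {f : M → ℝ} (hf : IsSmoothFun E f) (h_pos : ∀ p, 0 < f p)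
    (ξ : SmoothVF E M) (η : OneForm E M) : Metric E M where
  toFun p := f p • (g p).compl₁₂ (EndoField.horProj ξ η p) (EndoField.horProj ξ η p) +
    (η p).smulRight (η p)
  symm p u v := by
    change f p * g p _ _ + η p u * η p v = f p * g p _ _ + η p v * η p u
    rw [g.symm, mul_comm (η p u)]
  pos p v hv := by
    change 0 < f p * g p (EndoField.horProj ξ η p v) (EndoField.horProj ξ η p v) + η p v * η p v
    by_cases h_eta : η p v = 0
    · rw [EndoField.horProj_of_eta_eq_zero h_eta, h_eta, mul_zero, add_zero]
      exact mul_pos (h_pos p) (g.pos p v hv)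
    · have h_nonneg (w : TangentSpace 𝓘(ℝ, E) p) : 0 ≤ g p w w := by
        obtain rfl | hw := eq_or_ne w 0
        · rw [map_zero]
        · exact (g.pos p w hw).le
      exact add_pos_of_nonneg_of_pos (mul_nonneg (h_pos p).le (h_nonneg _)) (mul_self_pos.2 h_eta)
  smooth X Y := (hf.mul (g.smooth ((EndoField.horProj ξ η).apply X)
    ((EndoField.horProj ξ η).apply Y))).add ((η.smooth X).mul (η.smooth Y))

theorem Metric.deform_apply (g : Metric E M) {f : M → ℝ} (hf : IsSmoothFun E f)
    (h_pos : ∀ p, 0 < f p) (ξ : SmoothVF E M) (η : OneForm E M) (p : M)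
    (u v : TangentSpace 𝓘(ℝ, E) p) :
    g.deform hf h_pos ξ η p u v =
      f p * g p (EndoField.horProj ξ η p u) (EndoField.horProj ξ η p v) + η p u * η p v := rfl

theorem SasakianStructure.g_eq_d_add (S : SasakianStructure c E M) (X Y : SmoothVF E M) (p : M) :
    S.g p (X p) (Y p) = S.η.d c X (S.Φ.apply Y) p + S.η p (X p) * S.η p (Y p) := by
  rw [← S.contact_metric]
  exact sub_eq_iff_eq_add.1 (S.compatible p (X p) (Y p)).symm

namespace CRStructure

variable {C : CRStructure E M}

theorem isAdapted (hS : S ∈ C.sasakianStructures c) : C.IsAdapted S.ξ S.η S.Φ :=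
  ⟨⟨S.eta_xi, S.phi_sq⟩, hS.1, hS.2⟩

theorem exists_isSection_ne_zero (hE : 2 ≤ Module.finrank ℝ E) (p : M) :
    ∃ Y : SmoothVF E M, C.IsSection Y ∧ Y p ≠ 0 := by
  have h_pos : 0 < Module.finrank ℝ (C.D p) := by
    have := C.corank_one p
    omega
  have : Nontrivial (C.D p) := Module.nontrivial_of_finrank_pos h_pos
  obtain ⟨v, hv⟩ := exists_ne (0 : C.D p)
  obtain ⟨Y, hY, hYp⟩ := C.smooth_D p v
  exact ⟨Y, hY, hYp ▸ Subtype.coe_ne_coe.2 hv⟩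

theorem d_applyJ_pos (hS : S ∈ C.sasakianStructures c) {Y : SmoothVF E M} (hY : C.IsSection Y)
    {p : M} (hp : Y p ≠ 0) : 0 < S.η.d c Y (C.applyJ Y hY) p := by
  have h_g := S.g_eq_d_add Y Y p
  rw [hS.1.mem_iff.1 (hY p), mul_zero, add_zero, ← (isAdapted hS).applyJ_eq hY] at h_g
  exact h_g ▸ S.g.pos p _ hp

theorem eta_reeb_pos (hE : 2 ≤ Module.finrank ℝ E) (hS : S ∈ C.sasakianStructures c)
    (hS' : S' ∈ C.sasakianStructures c) (p : M) : 0 < S'.η p (S.ξ p) := by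
  obtain ⟨Y, hY, hp⟩ := C.exists_isSection_ne_zero hE p
  have h_pos := d_applyJ_pos hS' hY hp
  rw [hS.1.d_eq_mul S.eta_xi hS'.1 c hY (fun q => (C.J q ⟨Y q, hY q⟩).2)] at h_pos
  exact pos_of_mul_pos_left h_pos (d_applyJ_pos hS hY hp).le

theorem eq_of_reeb_eq (hS : S ∈ C.sasakianStructures c) (hS' : S' ∈ C.sasakianStructures c)
    (h : S.ξ = S'.ξ) : S = S' := by
  have h_eta : S.η = S'.η := OneForm.ext <| funext fun p => LinearMap.ext fun v => by
    rw [hS'.1.eq_mul S'.eta_xi hS.1, ← h, S.eta_xi, mul_one]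
  have h_phi : S.Φ = S'.Φ := EndoField.ext <| funext fun p => LinearMap.ext fun v => by
    have h_mem := hS.1.mem_iff.2 (OneForm.eta_horProj S.eta_xi p v)
    have h_J := (hS.2 p ⟨_, h_mem⟩).trans (hS'.2 p ⟨_, h_mem⟩).symm
    have h_phi_xi : S'.Φ p (S.ξ p) = 0 := h ▸ (isAdapted hS').phi_xi p
    simpa only [EndoField.horProj_apply, map_sub, map_smul, (isAdapted hS).phi_xi, h_phi_xi,
      smul_zero, sub_zero] using h_J
  refine SasakianStructure.ext h h_eta h_phi <| Metric.ext <| funext fun p =>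
    LinearMap.ext₂ fun u v => ?_
  obtain ⟨X, rfl⟩ := hS.1.exists_smoothVF_eq S.eta_xi p u
  obtain ⟨Y, rfl⟩ := hS.1.exists_smoothVF_eq S.eta_xi p v
  rw [S.g_eq_d_add, S'.g_eq_d_add, h_eta, h_phi]

theorem Represents.normalize {ξ : SmoothVF E M} {η : OneForm E M} (hη : C.Represents η)
    (h : ∀ p, η p (ξ p) ≠ 0) : C.Represents (OneForm.normalize ξ η h) := fun p => by
  rw [← hη p]
  exact LinearMap.ker_smul (η p) _ (inv_ne_zero (h p))

theorem IsAdapted.comp_horProj {ξ ξ' : SmoothVF E M} {η η' : OneForm E M} {Φ : EndoField E M}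
    (h : C.IsAdapted ξ η Φ) (hη' : C.Represents η') (hξ' : ∀ p, η' p (ξ' p) = 1) :
    C.IsAdapted ξ' η' (Φ.comp (EndoField.horProj ξ' η')) := by
  have h_phi (p : M) (v : TangentSpace 𝓘(ℝ, E) p) :
      Φ.comp (EndoField.horProj ξ' η') p v = Φ p (EndoField.horProj ξ' η' p v) := rfl
  have h_eta_phi (p : M) (v : TangentSpace 𝓘(ℝ, E) p) : η' p (Φ p v) = 0 :=
    hη'.mem_iff.1 (h.represents.mem_iff.2 (h.eta_phi p v))
  have h_eta (p : M) (v : TangentSpace 𝓘(ℝ, E) p) : η p (EndoField.horProj ξ' η' p v) = 0 :=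
    h.represents.mem_iff.1 (hη'.mem_iff.2 (OneForm.eta_horProj hξ' p v))
  refine ⟨⟨hξ', fun p v => ?_⟩, hη', fun p v => ?_⟩
  · rw [h_phi, h_phi, EndoField.horProj_of_eta_eq_zero (h_eta_phi p _), h.phi_sq, h_eta,
      zero_smul, add_zero, EndoField.horProj_apply, neg_sub, sub_eq_neg_add]
  · rw [h_phi, EndoField.horProj_of_eta_eq_zero (hη'.mem_iff.1 v.2), h.phi_eq_J]

variable [CompleteSpace E]

theorem preservesJ_reeb (hS : S ∈ C.sasakianStructures c) : C.PreservesJ S.ξ :=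
  (isAdapted hS).preservesJ_of_isNormal S.normal

theorem mem_crPos_iff (hE : 2 ≤ Module.finrank ℝ E) (hS : S ∈ C.sasakianStructures c)
    {X : SmoothVF E M} : X ∈ C.crPos c ↔ C.PreservesJ X ∧ ∀ p, 0 < S.η p (X p) := by
  refine ⟨fun h => ⟨h.1.2, h.2 S hS⟩,
    fun h => ⟨⟨h.1.isContactField hS.1 S.eta_xi, h.1⟩, fun S' hS' p => ?_⟩⟩
  rw [hS.1.eq_mul S.eta_xi hS'.1]
  exact mul_pos (h.2 p) (eta_reeb_pos hE hS hS' p)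

theorem reeb_mem_crPos (hE : 2 ≤ Module.finrank ℝ E) (hS : S ∈ C.sasakianStructures c) :
    S.ξ ∈ C.crPos c :=
  (mem_crPos_iff hE hS).2 ⟨preservesJ_reeb hS, fun p => S.eta_xi p ▸ one_pos⟩

variable [FiniteDimensional ℝ E] [T2Space M]

/-- The Sasakian structure with Reeb field `ξ` inducing the same CR structure as `S`; its contact
form is `η / η(ξ)`, where `η` is the contact form of `S`. -/
def deform (S : SasakianStructure c E M) (hS : S ∈ C.sasakianStructures c) (ξ : SmoothVF E M)
    (hξ : C.PreservesJ ξ) (h_pos : ∀ p, 0 < S.η p (ξ p)) : SasakianStructure c E M :=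
  let η := OneForm.normalize ξ S.η fun p => (h_pos p).ne'
  have hη : C.Represents η := hS.1.normalize _
  have h_xi (p : M) : η p (ξ p) = 1 := inv_mul_cancel₀ (h_pos p).ne'
  have h_adapted := (isAdapted hS).comp_horProj hη h_xi
  let π := EndoField.horProj ξ η
  have h_eta_phi (p : M) (v : TangentSpace 𝓘(ℝ, E) p) : η p (S.Φ p (π p v)) = 0 :=
    h_adapted.eta_phi p v
  have h_phi (p : M) (v : TangentSpace 𝓘(ℝ, E) p) : S.Φ.comp π p v = S.Φ p (π p v) := rfl
  { ξ := ξ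
    η := η
    Φ := S.Φ.comp π
    g := S.g.deform ((S.η.smooth ξ).inv₀ fun p => (h_pos p).ne') (fun p => inv_pos.2 (h_pos p)) ξ η
    eta_xi := h_xi
    phi_sq := h_adapted.phi_sq
    compatible p u v := by
      have h_eta (v : TangentSpace 𝓘(ℝ, E) p) : S.η p (π p v) = 0 :=
        hS.1.mem_iff.1 (hη.mem_iff.2 (OneForm.eta_horProj h_xi p v))
      rw [Metric.deform_apply, Metric.deform_apply, h_phi, h_phi, h_eta_phi, h_eta_phi,
        EndoField.horProj_of_eta_eq_zero (h_eta_phi p u),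
        EndoField.horProj_of_eta_eq_zero (h_eta_phi p v), S.compatible, h_eta, h_eta]
      ring
    contact_metric X Y p := by
      have h_reeb : η p (S.ξ p) = (S.η p (ξ p))⁻¹ := by
        change (S.η p (ξ p))⁻¹ * S.η p (S.ξ p) = _
        rw [S.eta_xi, mul_one]
      rw [OneForm.d_eq_d_horProj (hξ.d_apply_eq_zero hη h_xi c), hS.1.d_eq_mul S.eta_xi hη c
        (hη.isSection_horProj h_xi X) (hη.isSection_horProj h_xi Y), ← S.contact_metric, h_reeb,
        Metric.deform_apply, h_phi, h_eta_phi, EndoField.horProj_of_eta_eq_zero (h_eta_phi p _),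
        zero_mul, add_zero]
      rfl
    normal := h_adapted.isNormal_of_preservesJ hξ }

theorem deform_mem (hS : S ∈ C.sasakianStructures c) {ξ : SmoothVF E M} (hξ : C.PreservesJ ξ)
    (h_pos : ∀ p, 0 < S.η p (ξ p)) : deform S hS ξ hξ h_pos ∈ C.sasakianStructures c :=
  have hη := hS.1.normalize fun p => (h_pos p).ne'
  ⟨hη, ((isAdapted hS).comp_horProj hη fun p => inv_mul_cancel₀ (h_pos p).ne').phi_eq_J⟩

end CRStructure

end Sasakian

section Automorphisms

variable {E : Type*} [NormedAddCommGroup E] [NormedSpace ℝ E]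
  {M : Type*} [TopologicalSpace M] [ChartedSpace E M]

theorem mfderiv_diffeomorph_injective (φ : M ≃ₘ^∞⟮𝓘(ℝ, E), 𝓘(ℝ, E)⟯ M) (p : M) :
    Function.Injective (mfderiv 𝓘(ℝ, E) 𝓘(ℝ, E) φ p) :=
  (φ.mfderivToContinuousLinearEquiv (by simp) p).injective

variable [IsManifold 𝓘(ℝ, E) ∞ M]

section Pushforward

variable (φ : M ≃ₘ^∞⟮𝓘(ℝ, E), 𝓘(ℝ, E)⟯ M)

theorem pushforward_apply_apply (X : SmoothVF E M) (p : M) :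
    pushforward φ X (φ p) = mfderiv 𝓘(ℝ, E) 𝓘(ℝ, E) φ p (X p) := by
  have h_congr (p' : M) (hp : p' = p) : (mfderiv 𝓘(ℝ, E) 𝓘(ℝ, E) φ p' (X p') : E) =
      mfderiv 𝓘(ℝ, E) 𝓘(ℝ, E) φ p (X p) := by
    rw [hp]
  exact h_congr _ (φ.symm_apply_apply p)

theorem pushforward_pushforward_symm (X : SmoothVF E M) :
    pushforward φ (pushforward φ.symm X) = X := by
  ext q
  change mfderiv 𝓘(ℝ, E) 𝓘(ℝ, E) φ (φ.symm q) (pushforward φ.symm X (φ.symm q)) = X q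
  rw [pushforward_apply_apply, ← mfderiv_comp_apply q (φ.mdifferentiable (by simp) _)
    (φ.symm.mdifferentiable (by simp) q), show φ ∘ φ.symm = id from funext φ.apply_symm_apply,
    mfderiv_id]
  rfl

theorem pushforward_surjective : Function.Surjective (pushforward φ) := fun X =>
  ⟨_, pushforward_pushforward_symm φ X⟩

theorem mpullback_pushforward (X : SmoothVF E M) :
    VectorField.mpullback 𝓘(ℝ, E) 𝓘(ℝ, E) φ (pushforward φ X) = X := by
  funext p
  rw [VectorField.mpullback_apply, pushforward_apply_apply,
    ← φ.mfderivToContinuousLinearEquiv_coe (by simp), ContinuousLinearMap.inverse_equiv]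
  exact (φ.mfderivToContinuousLinearEquiv _ p).symm_apply_apply _

theorem bracket_pushforward [CompleteSpace E] (X Y : SmoothVF E M) (p : M) :
    bracket (pushforward φ X) (pushforward φ Y) (φ p) =
      mfderiv 𝓘(ℝ, E) 𝓘(ℝ, E) φ p (bracket X Y p) := by
  have : IsManifold 𝓘(ℝ, E) (minSmoothness ℝ 3) M := by
    rw [minSmoothness_of_isRCLikeNormedField]
    infer_instance
  have h_pullback := VectorField.mpullback_mlieBracket (I := 𝓘(ℝ, E)) (n := ∞)
    ((pushforward φ X).mdifferentiableAt (φ p)) ((pushforward φ Y).mdifferentiableAt (φ p))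
    φ.contMDiff.contMDiffAt (by
      rw [minSmoothness_of_isRCLikeNormedField]
      exact WithTop.coe_le_coe.2 le_top)
  rw [mpullback_pushforward, mpullback_pushforward, VectorField.mpullback_apply,
    ← φ.mfderivToContinuousLinearEquiv_coe (by simp),
    ContinuousLinearMap.inverse_equiv] at h_pullback
  exact (ContinuousLinearEquiv.symm_apply_eq _).1 h_pullback

end Pushforward

namespace CRStructure

variable {C : CRStructure E M} {ξ : SmoothVF E M} {η : OneForm E M} {Φ : EndoField E M}
  {φ : M ≃ₘ^∞⟮𝓘(ℝ, E), 𝓘(ℝ, E)⟯ M}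

theorem isSection_pushforward_iff (hφ : φ ∈ C.CRAut) (hη : C.Represents η) {X : SmoothVF E M} :
    C.IsSection (pushforward φ X) ↔ C.IsSection X := by
  obtain ⟨f, -, hf_ne, hf⟩ := hφ.1 η hη
  refine (EquivLike.surjective φ).forall.trans (forall_congr' fun p => ?_)
  rw [hη.mem_iff, hη.mem_iff, pushforward_apply_apply, hf, mul_eq_zero, or_iff_right (hf_ne p)]

namespace IsAdapted

variable (h : C.IsAdapted ξ η Φ) (hφ : φ ∈ C.CRAut)
include h hφ

theorem mfderiv_phi {p : M} {v : TangentSpace 𝓘(ℝ, E) p} (hv : η p v = 0) :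
    mfderiv 𝓘(ℝ, E) 𝓘(ℝ, E) φ p (Φ p v) = Φ (φ p) (mfderiv 𝓘(ℝ, E) 𝓘(ℝ, E) φ p v) := by
  obtain ⟨h_mem, h_J⟩ := hφ.2 p ⟨v, h.represents.mem_iff.2 hv⟩
  rwa [← h.phi_eq_J, ← h.phi_eq_J] at h_J

theorem apply_pushforward {X : SmoothVF E M} (hX : C.IsSection X) :
    Φ.apply (pushforward φ X) = pushforward φ (Φ.apply X) := by
  ext q
  obtain ⟨p, rfl⟩ := EquivLike.surjective φ q
  change Φ (φ p) (pushforward φ X (φ p)) = _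
  rw [pushforward_apply_apply, pushforward_apply_apply,
    ← h.mfderiv_phi hφ (h.represents.mem_iff.1 (hX p))]
  rfl

theorem preservesJ_pushforward_iff [CompleteSpace E] {X : SmoothVF E M} :
    C.PreservesJ (pushforward φ X) ↔ C.PreservesJ X := by
  obtain ⟨f, -, hf_ne, hf⟩ := hφ.1 η h.represents
  rw [h.preservesJ_iff, h.preservesJ_iff]
  refine (pushforward_surjective φ).forall.trans (forall_congr' fun Y =>
    imp_congr_ctx (isSection_pushforward_iff hφ h.represents) fun hY => ?_)
  refine (EquivLike.surjective φ).forall.trans (forall_congr' fun p => ?_)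
  rw [h.apply_pushforward hφ hY, bracket_pushforward, bracket_pushforward, hf, mul_eq_zero,
    or_iff_right (hf_ne p)]
  refine and_congr_right fun h_eta => ?_
  rw [← h.mfderiv_phi hφ h_eta, (mfderiv_diffeomorph_injective φ p).eq_iff]

end IsAdapted

variable {c : ℝ} {S : SasakianStructure c E M} [CompleteSpace E]

theorem conformalFactor_pos (hE : 2 ≤ Module.finrank ℝ E) (hS : S ∈ C.sasakianStructures c)
    (hφ : φ ∈ C.CRAut) {p : M} {a : ℝ} (ha : ∀ v : TangentSpace 𝓘(ℝ, E) p,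
      S.η (φ p) (mfderiv 𝓘(ℝ, E) 𝓘(ℝ, E) φ p v) = a * S.η p v) : 0 < a := by
  have h := isAdapted hS
  obtain ⟨Y, hY, hp⟩ := C.exists_isSection_ne_zero hE p
  have hφY := (isSection_pushforward_iff hφ hS.1).2 hY
  have hΦY : C.IsSection (S.Φ.apply Y) := fun q => hS.1.mem_iff.2 (h.eta_phi q (Y q))
  have h_levi : 0 < S.η.d c Y (S.Φ.apply Y) p := h.applyJ_eq hY ▸ d_applyJ_pos hS hY hp
  have h_levi_image : 0 < S.η.d c (pushforward φ Y) (pushforward φ (S.Φ.apply Y)) (φ p) := by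
    rw [← h.apply_pushforward hφ hY, ← h.applyJ_eq hφY]
    refine d_applyJ_pos hS hφY ?_
    rwa [pushforward_apply_apply, map_ne_zero_iff _ (mfderiv_diffeomorph_injective φ p)]
  rw [hS.1.d_of_isSection c hφY ((isSection_pushforward_iff hφ hS.1).2 hΦY), bracket_pushforward,
    ha, mul_left_comm, ← mul_neg, ← hS.1.d_of_isSection c hY hΦY] at h_levi_image
  exact pos_of_mul_pos_left h_levi_image h_levi.le

theorem pushforward_mem_crPos_iff (hE : 2 ≤ Module.finrank ℝ E) (hS : S ∈ C.sasakianStructures c)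
    (hφ : φ ∈ C.CRAut) {X : SmoothVF E M} : pushforward φ X ∈ C.crPos c ↔ X ∈ C.crPos c := by
  obtain ⟨f, -, -, hf⟩ := hφ.1 S.η hS.1
  rw [mem_crPos_iff hE hS, mem_crPos_iff hE hS, (isAdapted hS).preservesJ_pushforward_iff hφ,
    (EquivLike.surjective φ).forall]
  refine and_congr_right fun _ => forall_congr' fun p => ?_
  rw [pushforward_apply_apply, hf, mul_pos_iff_of_pos_left (conformalFactor_pos hE hS hφ (hf p))]

theorem pushforward_image_crPos (hE : 2 ≤ Module.finrank ℝ E) (hS : S ∈ C.sasakianStructures c)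
    (hφ : φ ∈ C.CRAut) : pushforward φ '' C.crPos c = C.crPos c := by
  have h_preimage : pushforward φ ⁻¹' C.crPos c = C.crPos c :=
    Set.ext fun _ => pushforward_mem_crPos_iff hE hS hφ
  conv_lhs => rw [← h_preimage]
  exact Set.image_preimage_eq _ (pushforward_surjective φ)

end CRStructure

end Automorphisms

section Openness

variable {E : Type*} [NormedAddCommGroup E] [NormedSpace ℝ E]
  {M : Type*} [TopologicalSpace M] [ChartedSpace E M] [IsManifold 𝓘(ℝ, E) ∞ M]

namespace SmoothVF

theorem localRep_extChartAt (X : SmoothVF E M) {p q : M} (hq : q ∈ (extChartAt 𝓘(ℝ, E) p).source) :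
    X.localRep p (extChartAt 𝓘(ℝ, E) p q) =
      (trivializationAt E (fun p : M => TangentSpace 𝓘(ℝ, E) p) p ⟨q, X q⟩).2 := by
  rw [localRep, (extChartAt 𝓘(ℝ, E) p).left_inv hq]

theorem tendstoUniformlyOn_localRep (X : SmoothVF E M) (p : M) {K : Set E} (hK : IsCompact K)
    (h_target : K ⊆ (extChartAt 𝓘(ℝ, E) p).target) :
    TendstoUniformlyOn (fun Y : SmoothVF E M => Y.localRep p) (X.localRep p) (𝓝 X) K := by
  have h_cont : Continuous (fun Y : SmoothVF E M =>
      UniformOnFun.ofFun {K : Set E | IsCompact K ∧ K ⊆ (extChartAt 𝓘(ℝ, E) p).target}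
        (iteratedFDeriv ℝ 0 (Y.localRep p))) :=
    continuous_iInf_dom (i := p) (continuous_iInf_dom (i := 0) continuous_induced_dom)
  have h_unif := UniformOnFun.tendsto_iff_tendstoUniformlyOn.1 (h_cont.tendsto X) K ⟨hK, h_target⟩
  exact (continuousMultilinearCurryFin0 ℝ E E).isometry.uniformContinuous.comp_tendstoUniformlyOn
    h_unif

end SmoothVF

namespace OneForm

variable [FiniteDimensional ℝ E] [T2Space M] (η : OneForm E M)

theorem exists_eventually_abs_le (p : M) :
    ∃ K : ℝ, 0 ≤ K ∧ ∀ᶠ q in 𝓝 p, ∀ v : TangentSpace 𝓘(ℝ, E) q, |η q v| ≤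
      K * ‖(trivializationAt E (fun p : M => TangentSpace 𝓘(ℝ, E) p) p ⟨q, v⟩).2‖ := by
  obtain ⟨e, he⟩ := SmoothVF.exists_frame (E := E) p
  let b := Module.finBasis ℝ E
  have h_frame (i) : ∀ᶠ q in 𝓝 p, |η q (e i q)| < |η p (e i p)| + 1 :=
    (η.smooth (e i)).continuous.abs.continuousAt.eventually_lt continuousAt_const (lt_add_one _)
  refine ⟨∑ i, ‖(b.coord i).toContinuousLinearMap‖ * (|η p (e i p)| + 1), by positivity, ?_⟩
  filter_upwards [he, Filter.eventually_all.2 h_frame] with q hq hq_lt v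
  set w := (trivializationAt E (fun p : M => TangentSpace 𝓘(ℝ, E) p) p ⟨q, v⟩).2
  have h_coord (i) : |b.repr w i| ≤ ‖(b.coord i).toContinuousLinearMap‖ * ‖w‖ :=
    (b.coord i).toContinuousLinearMap.le_opNorm w
  calc |η q v| = |∑ i, b.repr w i * η q (e i q)| := by
        conv_lhs => rw [hq v, map_sum]
        simp only [map_smul, smul_eq_mul, b, w]
    _ ≤ ∑ i, |b.repr w i * η q (e i q)| := Finset.abs_sum_le_sum_abs _ _
    _ ≤ ∑ i, ‖(b.coord i).toContinuousLinearMap‖ * (|η p (e i p)| + 1) * ‖w‖ :=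
        Finset.sum_le_sum fun i _ => by
          rw [abs_mul, mul_right_comm]
          gcongr
          exacts [h_coord i, (hq_lt i).le]
    _ = _ := (Finset.sum_mul ..).symm

/-- The contraction `η(X)` of a `1`-form with a vector field, as a continuous function. -/
def contract (X : SmoothVF E M) : C(M, ℝ) :=
  ⟨fun p => η p (X p), (η.smooth X).continuous⟩

theorem continuous_contract : Continuous η.contract := by
  have := Manifold.locallyCompact_of_finiteDimensional (M := M) 𝓘(ℝ, E)
  refine continuous_iff_continuousAt.2 fun X =>
    ContinuousMap.tendsto_of_tendstoLocallyUniformly (Metric.tendstoLocallyUniformly_iff.2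
      fun ε hε p => ?_)
  obtain ⟨K, hK, h_bound⟩ := η.exists_eventually_abs_le p
  obtain ⟨δ, hδ, hKδ⟩ := exists_pos_mul_lt hε K
  obtain ⟨s, hs, hs_sub, hs_compact⟩ := local_compact_nhds
    ((h_bound.and (extChartAt_source_mem_nhds (I := 𝓘(ℝ, E)) p)).and
      ((trivializationAt E (fun p : M => TangentSpace 𝓘(ℝ, E) p) p).open_baseSet.mem_nhds
        (FiberBundle.mem_baseSet_trivializationAt' p)))
  have h_image : IsCompact (extChartAt 𝓘(ℝ, E) p '' s) := hs_compact.image_of_continuousOn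
    ((continuousOn_extChartAt p).mono fun q hq => (hs_sub hq).1.2)
  have h_target : extChartAt 𝓘(ℝ, E) p '' s ⊆ (extChartAt 𝓘(ℝ, E) p).target :=
    Set.image_subset_iff.2 fun q hq => (extChartAt 𝓘(ℝ, E) p).map_source (hs_sub hq).1.2
  refine ⟨s, hs, ?_⟩
  filter_upwards [Metric.tendstoUniformlyOn_iff.1
    (X.tendstoUniformlyOn_localRep p h_image h_target) δ hδ] with Y hY q hq
  obtain ⟨⟨hq_bound, hq_source⟩, hq_base⟩ := hs_sub hq
  have h_dist := hY _ ⟨q, hq, rfl⟩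
  rw [X.localRep_extChartAt hq_source, Y.localRep_extChartAt hq_source, dist_eq_norm] at h_dist
  have h_sub := (Bundle.Trivialization.linear ℝ
    (trivializationAt E (fun p : M => TangentSpace 𝓘(ℝ, E) p) p) hq_base).map_sub (X q) (Y q)
  calc dist (η q (X q)) (η q (Y q)) = |η q (X q - Y q)| := by rw [map_sub, Real.dist_eq]
    _ ≤ _ := hq_bound _
    _ ≤ K * δ := mul_le_mul_of_nonneg_left (h_sub ▸ h_dist.le) hK
    _ < ε := hKδ

theorem isOpen_setOf_forall_pos [CompactSpace M] :
    IsOpen {X : SmoothVF E M | ∀ p, 0 < η p (X p)} := by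
  have h_preimage : {X : SmoothVF E M | ∀ p, 0 < η p (X p)} =
      η.contract ⁻¹' {f | Set.MapsTo f Set.univ (Set.Ioi 0)} :=
    Set.ext fun _ => Set.mapsTo_univ_iff.symm
  rw [h_preimage]
  exact (ContinuousMap.isOpen_setOfPred_mapsTo isCompact_univ isOpen_Ioi).preimage
    η.continuous_contract

end OneForm

end Openness

section PositiveCone

variable {E : Type*} [NormedAddCommGroup E] [NormedSpace ℝ E]
  {M : Type*} [TopologicalSpace M] [ChartedSpace E M] [IsManifold 𝓘(ℝ, E) ∞ M]
  {C : CRStructure E M} {c : ℝ} {S : SasakianStructure c E M} [CompleteSpace E]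

namespace CRStructure

theorem add_mem_crPos {X Y : SmoothVF E M} (hX : X ∈ C.crPos c) (hY : Y ∈ C.crPos c) :
    X + Y ∈ C.crPos c := by
  refine ⟨C.cr.add_mem hX.1 hY.1, fun S hS p => ?_⟩
  rw [ContMDiffSection.coe_add, Pi.add_apply, map_add]
  exact add_pos (hX.2 S hS p) (hY.2 S hS p)

theorem smul_mem_crPos {a : ℝ} (ha : 0 < a) {X : SmoothVF E M} (hX : X ∈ C.crPos c) :
    a • X ∈ C.crPos c := by
  refine ⟨C.cr.smul_mem a hX.1, fun S hS p => ?_⟩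
  rw [ContMDiffSection.coe_smul, Pi.smul_apply, map_smul]
  exact smul_pos ha (hX.2 S hS p)

theorem convex_crPos : Convex ℝ {X : C.cr | X.1 ∈ C.crPos c} :=
  convex_iff_forall_pos.2 fun _ hX _ hY _ _ ha hb _ =>
    add_mem_crPos (smul_mem_crPos ha hX) (smul_mem_crPos hb hY)

variable [T2Space M]

theorem isOpen_crPos [CompactSpace M] (hE : 2 ≤ Module.finrank ℝ E)
    (hS : S ∈ C.sasakianStructures c) : IsOpen {X : C.cr | X.1 ∈ C.crPos c} := by
  have : FiniteDimensional ℝ E := Module.finite_of_finrank_pos (by omega)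
  have h_preimage : {X : C.cr | X.1 ∈ C.crPos c} =
      Subtype.val ⁻¹' {X : SmoothVF E M | ∀ p, 0 < S.η p (X p)} :=
    Set.ext fun X => (mem_crPos_iff hE hS).trans (and_iff_right X.2.2)
  exact h_preimage ▸ S.η.isOpen_setOf_forall_pos.preimage continuous_subtype_val

/-- The bijection `(ξ, η, Φ, g) ↦ ξ` from the Sasakian structures compatible with `(𝒟, J)` onto
`𝔠𝔯⁺(𝒟, J)`. -/
def reebEquiv (hE : 2 ≤ Module.finrank ℝ E) (hC : C.IsSasakiType c) :
    C.sasakianStructures c ≃ C.crPos c :=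
  Equiv.ofBijective (fun S => ⟨S.1.ξ, reeb_mem_crPos hE S.2⟩)
    ⟨fun S S' h => Subtype.ext (eq_of_reeb_eq S.2 S'.2 (congrArg Subtype.val h)), fun ξ => by
      have : FiniteDimensional ℝ E := Module.finite_of_finrank_pos (by omega)
      obtain ⟨S, hS⟩ := hC
      exact ⟨⟨_, deform_mem hS ξ.2.1.2 (ξ.2.2 S hS)⟩, rfl⟩⟩

theorem reebEquiv_symm_eta (hE : 2 ≤ Module.finrank ℝ E) (hC : C.IsSasakiType c)
    (S : C.sasakianStructures c) (ξ : C.crPos c) (p : M) (v : TangentSpace 𝓘(ℝ, E) p) :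
    ((reebEquiv hE hC).symm ξ).1.η p v = S.1.η p v / S.1.η p (ξ.1 p) := by
  obtain ⟨S', rfl⟩ := (reebEquiv hE hC).surjective ξ
  rw [Equiv.symm_apply_apply, S'.2.1.eq_mul S'.1.eta_xi S.2.1 p v]
  exact (mul_div_cancel_right₀ _ (eta_reeb_pos hE S'.2 S.2 p).ne').symm

end CRStructure

end PositiveCone

end SasakiCR

end

theorem lemma6p3_general {E : Type*} [NormedAddCommGroup E] [NormedSpace ℝ E] [CompleteSpace E]
    (hE : 2 ≤ Module.finrank ℝ E) {M : Type*} [TopologicalSpace M] [ChartedSpace E M]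
    [IsManifold 𝓘(ℝ, E) ∞ M] [T2Space M] {c : ℝ} {C : SasakiCR.CRStructure E M}
    (hC : C.IsSasakiType c) :
    (∃ ι : C.sasakianStructures c ≃ C.crPos c,
      (∀ S : C.sasakianStructures c, (ι S).1 = S.1.ξ) ∧
      ∀ (S₀ : C.sasakianStructures c) (ξ : C.crPos c) (p : M) (v : TangentSpace 𝓘(ℝ, E) p),
        (ι.symm ξ).1.η p v = S₀.1.η p v / S₀.1.η p (ξ.1 p)) ∧
    ((CompactSpace M → IsOpen {X : C.cr | X.1 ∈ C.crPos c}) ∧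
      Convex ℝ {X : C.cr | X.1 ∈ C.crPos c} ∧
      ∀ a : ℝ, 0 < a → ∀ X : C.cr, X.1 ∈ C.crPos c → (a • X).1 ∈ C.crPos c) ∧
    (∀ φ ∈ C.CRAut, SasakiCR.pushforward φ '' C.crPos c = C.crPos c) := by
  obtain ⟨S, hS⟩ := id hC
  exact ⟨⟨SasakiCR.CRStructure.reebEquiv hE hC, fun _ => rfl,
      SasakiCR.CRStructure.reebEquiv_symm_eta hE hC⟩,
    ⟨fun _ => SasakiCR.CRStructure.isOpen_crPos hE hS, SasakiCR.CRStructure.convex_crPos,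
      fun _ ha _ hX => SasakiCR.CRStructure.smul_mem_crPos ha hX⟩,
    fun _ hφ => SasakiCR.CRStructure.pushforward_image_crPos hE hS hφ⟩

theorem lemma6p3 (n : ℕ) (hn : 1 ≤ n) (M : Type*) [TopologicalSpace M]
    [ChartedSpace (EuclideanSpace ℝ (Fin (2 * n + 1))) M]
    [IsManifold 𝓘(ℝ, EuclideanSpace ℝ (Fin (2 * n + 1))) ∞ M]
    [T2Space M] [SecondCountableTopology M]
    (c : ℝ) (hc : 0 < c)
    (C : SasakiCR.CRStructure (EuclideanSpace ℝ (Fin (2 * n + 1))) M)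
    (hC : C.IsStrictlyPseudoconvex) (hS : C.IsSasakiType c) :
    (∃ ι : C.sasakianStructures c ≃ C.crPos c,
      (∀ S : C.sasakianStructures c, (ι S).1 = S.1.ξ) ∧
      ∀ (S₀ : C.sasakianStructures c) (ξ : C.crPos c) (p : M)
        (v : TangentSpace 𝓘(ℝ, EuclideanSpace ℝ (Fin (2 * n + 1))) p),
        (ι.symm ξ).1.η p v = S₀.1.η p v / S₀.1.η p (ξ.1 p)) ∧
    ((CompactSpace M → IsOpen {X : C.cr | X.1 ∈ C.crPos c}) ∧
      Convex ℝ {X : C.cr | X.1 ∈ C.crPos c} ∧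
      ∀ a : ℝ, 0 < a → ∀ X : C.cr, X.1 ∈ C.crPos c → (a • X).1 ∈ C.crPos c) ∧
    (∀ φ ∈ C.CRAut, SasakiCR.pushforward φ '' C.crPos c = C.crPos c) := by
  have hE : 2 ≤ Module.finrank ℝ (EuclideanSpace ℝ (Fin (2 * n + 1))) := by
    rw [finrank_euclideanSpace_fin]
    omega
  exact lemma6p3_general hE hS
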